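/- Let $K$ be a number field and let $v$ be a non-archimedean place of $K$ that does not divide $2$, with absolute value $|\cdot| = |\cdot|_v$ (in any normalization). Let $\mathbb{C}_v$ be the completion of an algebraic closure of $K_v$, and let $\mathbf{A}^{1,an}_v$ be the Berkovich affine line over $\mathbb{C}_v$, i.e. the space of multiplicative seminorms $P \mapsto |P|_x$ on $\mathbb{C}_v[X]$ extending $|\cdot|$. For $c \in K$ let $f_c(z) = z^2 + c$, let $$\lambda_c(x) = \lim_{n\to\infty} \frac{1}{2^n} \log \max\{ |f_c^n|_x, 1 \}, \qquad x \in \mathbf{A}^{1,an}_v,$$ be its escape rate (so $\lambda_c(z) = \lim_n 2^{-n}\log\max\{|f_c^n(z)|,1\}$ at the points $z\in\mathbb{C}_v$), and let $\mu_c$ be its canonical measure, the probability measure on $\mathbf{A}^{1,an}_v$ that is the Laplacian of $\lambda_c$. For $c_1, c_2 \in K$ put $$E_v = \int_{\mathbf{A}^{1,an}_v} \lambda_{c_1} \, d\mu_{c_2} .$$ Then, for all $c_1, c_2 \in K$, the function $\lambda_{c_1}$ is $\mu_{c_2}$-integrable and $$\frac14 \log^+ |c_1 - c_2| \;\le\;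 E_v \;\le\; \frac12 \log^+ \max\{|c_1|, |c_2|\},$$ where $\log^+ t = \max\{\log t, 0\}$ and $\log^+ 0 = 0$. Furthermore, if $r := |c_1| = |c_2| > 1$ and $|c_1 - c_2| > r^{-1/2}$, then $$E_v \;\ge\; \frac{1}{16} \log r .$$ -/

import Mathlib

open scoped Polynomial Real
open Polynomial MeasureTheory Topology Filter

noncomputable section

/-! ### Non-archimedean places and the field `ℂ_v` -/

/-- A non-archimedean place of a field `K`, given by a nontrivial non-archimedean absolute value
`|·|_v` in its equivalence class. Every normalization of `|·|_v` is allowed. -/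
structure NonarchPlace (K : Type*) [Field K] where
  /-- the absolute value `|·|_v` -/
  abv : AbsoluteValue K ℝ
  isNonarchimedean : IsNonarchimedean abv
  isNontrivial : abv.IsNontrivial

namespace NonarchPlace

variable {K : Type*} [Field K] (v : NonarchPlace K)

instance : IsUltrametricDist (WithAbs v.abv) :=
  IsUltrametricDist.isUltrametricDist_of_forall_norm_add_le_max_norm fun x y =>
    v.isNonarchimedean x.ofAbs y.ofAbs

/-- `K_v`, the completion of `K` at `v`. -/
abbrev LocalField : Type _ := v.abv.Completion

instance : IsUltrametricDist v.LocalField :=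
  IsUltrametricDist.of_normedAlgebra (WithAbs v.abv)

instance : NontriviallyNormedField v.LocalField where
  non_trivial := by
    obtain ⟨x, hx⟩ := v.isNontrivial.exists_abv_gt_one
    refine ⟨((WithAbs.toAbs v.abv x : WithAbs v.abv) : v.LocalField), ?_⟩
    rw [UniformSpace.Completion.norm_coe]
    exact hx

/-- An algebraic closure of `K_v`. -/
abbrev LocalAlgCl : Type _ := AlgebraicClosure v.LocalField

/-- The absolute value on the algebraic closure is the unique extension of `|·|_v`. -/
instance : NormedField v.LocalAlgCl := spectralNorm.normedField v.LocalField v.LocalAlgCl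

instance : NormedAlgebra v.LocalField v.LocalAlgCl := spectralNorm.normedAlgebra _ _

instance : IsUltrametricDist v.LocalAlgCl :=
  IsUltrametricDist.isUltrametricDist_of_forall_norm_add_le_max_norm
    (isNonarchimedean_spectralNorm (K := v.LocalField) (L := v.LocalAlgCl))

/-- `ℂ_v`, the completion of an algebraic closure of `K_v`. -/
abbrev Cv : Type _ := UniformSpace.Completion v.LocalAlgCl

instance : IsUltrametricDist v.Cv := IsUltrametricDist.of_normedAlgebra v.LocalAlgCl

/-- The embedding of `K` in `ℂ_v`. -/
def toCv : K →+* v.Cv :=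
  (UniformSpace.Completion.coeRingHom (α := v.LocalAlgCl)).comp
    ((algebraMap v.LocalField v.LocalAlgCl).comp
      ((UniformSpace.Completion.coeRingHom (α := WithAbs v.abv)).comp
        (WithAbs.equiv v.abv).symm.toRingHom))

theorem norm_toCv (x : K) : ‖v.toCv x‖ = v.abv x := by
  have h1 : ‖v.toCv x‖ = ‖algebraMap v.LocalField v.LocalAlgCl
      ((WithAbs.toAbs v.abv x : WithAbs v.abv) : v.LocalField)‖ :=
    UniformSpace.Completion.norm_coe _
  have h2 : ‖algebraMap v.LocalField v.LocalAlgCl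
      ((WithAbs.toAbs v.abv x : WithAbs v.abv) : v.LocalField)‖ =
      ‖((WithAbs.toAbs v.abv x : WithAbs v.abv) : v.LocalField)‖ := norm_algebraMap' _ _
  rw [h1, h2, UniformSpace.Completion.norm_coe]
  rfl

end NonarchPlace

/-! ### The Berkovich affine line -/

/-- The Berkovich affine line over a normed field `L`: the multiplicative seminorms on `L[X]` that
extend the absolute value of `L`. -/
def BerkovichLine (L : Type*) [NormedField L] : Type _ :=
  {x : MulRingSeminorm L[X] // ∀ a : L, x (C a) = ‖a‖}

namespace BerkovichLine

variable {L : Type*} [NormedField L]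

/-- `x.eval P` is the value `|P|_x` at `P` of the seminorm `x`. -/
def eval (x : BerkovichLine L) (P : L[X]) : ℝ := x.1 P

/-- The Berkovich topology: the coarsest one making every `x ↦ |P|_x` continuous. -/
instance : TopologicalSpace (BerkovichLine L) :=
  TopologicalSpace.induced (fun x P => x.eval P) inferInstance

instance : MeasurableSpace (BerkovichLine L) := borel _

instance : BorelSpace (BerkovichLine L) := ⟨rfl⟩

/-- The type I point of `z ∈ L`: the seminorm `P ↦ |P(z)|`. -/
def ofPoint (z : L) : BerkovichLine L :=
  ⟨{ toFun := fun P => ‖P.eval z‖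
     map_zero' := by simp
     add_le' := fun P Q => by simpa using norm_add_le (P.eval z) (Q.eval z)
     neg' := fun P => by simp
     map_one' := by simp
     map_mul' := fun P Q => by simp }, fun a => show ‖(C a).eval z‖ = ‖a‖ by simp⟩

variable [IsUltrametricDist L]

/-- The point `ζ_{a,r}` of the disk with centre `a` and radius `r > 0`: the seminorm
`∑ bᵢ (X - a)ⁱ ↦ maxᵢ |bᵢ| rⁱ`. -/
def diskPoint (a : L) (r : {r : ℝ // 0 < r}) : BerkovichLine L :=
  have hna : IsNonarchimedean (NormedField.toAbsoluteValue L) := IsUltrametricDist.norm_add_le_max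
  ⟨{ toFun := fun P => (taylor a P).gaussNorm (NormedField.toAbsoluteValue L) r
     map_zero' := by simp
     add_le' := fun P Q => by
      have h0 := fun R : L[X] => R.gaussNorm_nonneg (NormedField.toAbsoluteValue L) r.2.le
      have := isNonarchimedean_gaussNorm _ hna r.2.le (taylor a P) (taylor a Q)
      rw [map_add]
      exact this.trans (max_le_add_of_nonneg (h0 _) (h0 _))
     neg' := fun P => by
      have h : taylor a (-P) = C (-1 : L) * taylor a P := by simp
      rw [h, gaussNorm_mul hna r.2, gaussNorm_C, AbsoluteValue.map_neg, map_one, one_mul]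
     map_one' := by
      rw [taylor_one, gaussNorm_C, map_one]
     map_mul' := fun P Q => by
      rw [taylor_mul, gaussNorm_mul hna r.2] },
   fun b => show (taylor a (C b)).gaussNorm (NormedField.toAbsoluteValue L) (r : ℝ) = ‖b‖ by
      rw [taylor_C, gaussNorm_C]; rfl⟩

/-- The function `x ↦ log max(|X - a|_x, r)` on the Berkovich line. Its Laplacian on the affine
line is the Dirac mass at `ζ_{a,r}`. -/
def diskPotential (a : L) (r : {r : ℝ // 0 < r}) (x : BerkovichLine L) : ℝ :=
  Real.log (max (x.eval (X - C a)) r)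

/-- `Δ u = μ` on the Berkovich affine line, in the sense of distributions: `∫ φ dμ = ∫ u d(Δ φ)`
for the compactly supported test functions
`φ = log max(|X - a|, r) - log max(|X - b|, s)`, for which `Δ φ = δ_{ζ_{a,r}} - δ_{ζ_{b,s}}`.
The linear combinations of these `φ` are all the compactly supported functions that are
piecewise affine on a finite subtree (and locally constant off it), the usual test functions of
potential theory on the line. -/
def HasLaplacian (u : BerkovichLine L → ℝ) (μ : Measure (BerkovichLine L)) : Prop :=
  ∀ (a b : L) (r s : {r : ℝ // 0 < r}),
    ∫ x, (diskPotential a r x - diskPotential b s x) ∂μ = u (diskPoint a r) - u (diskPoint b s)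

end BerkovichLine

/-! ### Dynamics of `f_c(z) = z² + c` -/

section Dynamics

open BerkovichLine

variable {L : Type*} [NormedField L]

/-- The `n`-th iterate of `f_c = X² + c`, as a polynomial. -/
def iterPoly (c : L) (n : ℕ) : L[X] := (fun P : L[X] => P ^ 2 + C c)^[n] X

theorem eval_iterPoly (c z : L) (n : ℕ) :
    (iterPoly c n).eval z = (fun w : L => w ^ 2 + c)^[n] z := by
  induction n with
  | zero => simp [iterPoly]
  | succ n ih =>
    rw [Function.iterate_succ_apply', ← ih, iterPoly, Function.iterate_succ_apply', ← iterPoly]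
    simp

/-- The escape rate `λ_c(x) = lim 2⁻ⁿ log max(|f_c^n|_x, 1)` on the Berkovich line. -/
def escapeRate (c : L) (x : BerkovichLine L) : ℝ :=
  limUnder atTop fun n : ℕ => (1 / 2 ^ n : ℝ) * Real.log (max (x.eval (iterPoly c n)) 1)

/-- On type I points `escapeRate` is the classical escape rate
`λ_c(z) = lim 2⁻ⁿ log max(|f_c^n(z)|, 1)`. -/
theorem escapeRate_ofPoint (c z : L) :
    escapeRate c (ofPoint z) = limUnder atTop fun n : ℕ =>
      (1 / 2 ^ n : ℝ) * Real.log (max ‖(fun w : L => w ^ 2 + c)^[n] z‖ 1) := by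
  simp_rw [← eval_iterPoly]
  rfl

variable [IsUltrametricDist L]

open Classical in
/-- The canonical (equilibrium) measure `μ_c` of `f_c`: the probability measure on the Berkovich
affine line that is the Laplacian of `λ_c`. -/
def canonicalMeasure (c : L) : Measure (BerkovichLine L) :=
  if h : ∃ μ : Measure (BerkovichLine L), IsProbabilityMeasure μ ∧ HasLaplacian (escapeRate c) μ
  then h.choose else 0

end Dynamics

namespace NonarchPlace

variable {K : Type*} [Field K] (v : NonarchPlace K)

/-- The local energy `E_v = ∫ λ_{c₁,v} dμ_{c₂,v}` over the Berkovich affine line over `ℂ_v`. -/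
def localEnergy (c₁ c₂ : K) : ℝ :=
  ∫ x, escapeRate (v.toCv c₁) x ∂(canonicalMeasure (v.toCv c₂))

end NonarchPlace

end

noncomputable section

/-! ### Nontriviality of the norm and square roots in `ℂ_v` -/

namespace NonarchPlace

/-! The proof uses only that the field is ultrametric, has square roots, and satisfies |2| = 1.
Write g_{a,r} = log max(|X - a|, r) and let ζ_{a,r} be the point of the disk. Two facts drive
everything. First, g_{a,r}(ζ_{b,s}) is symmetric in the two disks (`diskPotential_diskPoint_comm`).
Second, because |2| = 1, the pullback of g_{b,r} under z² + c is the sum of the potentials of two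
disks centred at ±√(b - c) (`diskPotential_quadMap`). So averaging potentials over the n-th
preimages of the Gauss point gives exactly 2⁻ⁿ log max(|f_cⁿ|, 1), the n-th approximation of λ_c.

By symmetry, a limit of these preimage averages is a measure with Laplacian potential λ_c, so
`canonicalMeasure` is a genuine probability measure (`canonicalMeasure_spec`). Its Laplacian
property gives ∫ g_{a,r} dμ_c = λ_c(ζ_{a,r}). Hence, with c = c₂ and c' = c₁, the energy is the
limit of the averages of λ_c over the n-th preimages of the Gauss point under f_{c'}
(`tendsto_preimageAvg_pow`).

All these preimages lie in the disk of radius max(1, √|c'|), where λ_c is at most the logarithm of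
the larger escape radius; this is the upper bound. For the lower bounds it suffices to bound below,
for each z in that disk, the average of λ_c over the k-th preimages of z under f_{c'}
(`le_integral_escapeRate`). If |c| ≠ |c'|, then k ≤ 1 is enough. If |c| = |c'| = s² > 1 and δ = c' -
c, then f_c iterated on a k-th preimage of z returns to z up to an explicit error in δ. This error
exceeds the escape radius s for k = 1, 2, 3 when |δ| > s, 1 < |δ| ≤ s, 1/s < |δ| ≤ 1 respectively,
for at least half of the preimages. -/

instance {K : Type*} [Field K] (v : NonarchPlace K) : NontriviallyNormedField v.Cv where
  __ := (inferInstance : NormedField v.Cv)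
  non_trivial := by
    obtain ⟨x, hx⟩ := v.isNontrivial.exists_abv_gt_one
    exact ⟨v.toCv x, by rwa [← v.norm_toCv] at hx⟩

theorem exists_sq_eq {K : Type*} [Field K] [CharZero K] (v : NonarchPlace K) (u : v.Cv) :
    ∃ w, w ^ 2 = u := by
  have : CharZero v.Cv := (RingHom.charZero_iff v.toCv.injective).1 inferInstance
  have : IsAlgClosed v.Cv := IsAlgClosed.of_denseRange UniformSpace.Completion.denseRange_coe
  exact IsAlgClosed.exists_pow_nat_eq u (by norm_num)

end NonarchPlace

/-! ### Geometry and topology of the Berkovich line -/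

section Ultrametric

variable {L : Type*} [NormedField L] [IsUltrametricDist L]

theorem IsUltrametricDist.norm_add_eq_of_lt {a b : L} (h : ‖b‖ < ‖a‖) : ‖a + b‖ = ‖a‖ := by
  rw [IsUltrametricDist.norm_add_eq_max_of_norm_ne_norm h.ne', max_eq_left h.le]

theorem IsUltrametricDist.norm_sub_le_of_le {a b : L} {t : ℝ} (ha : ‖a‖ ≤ t) (hb : ‖b‖ ≤ t) :
    ‖a - b‖ ≤ t := by
  rw [sub_eq_add_neg]
  exact (IsUltrametricDist.norm_add_le_max a (-b)).trans (max_le ha (by rwa [norm_neg]))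

end Ultrametric

namespace BerkovichLine

variable {L : Type*} [NormedField L]

section Seminorm

variable (x : BerkovichLine L)

theorem eval_C (a : L) : x.eval (C a) = ‖a‖ := x.2 a

theorem eval_zero : x.eval 0 = 0 := map_zero x.1

theorem eval_one : x.eval 1 = 1 := map_one x.1

theorem eval_add_le (P Q : L[X]) : x.eval (P + Q) ≤ x.eval P + x.eval Q := map_add_le_add x.1 P Q

theorem eval_neg (P : L[X]) : x.eval (-P) = x.eval P := map_neg_eq_map x.1 P

theorem eval_mul (P Q : L[X]) : x.eval (P * Q) = x.eval P * x.eval Q := map_mul x.1 P Q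

theorem eval_nonneg (P : L[X]) : 0 ≤ x.eval P := apply_nonneg x.1 P

theorem eval_pow (P : L[X]) (n : ℕ) : x.eval (P ^ n) = x.eval P ^ n := map_pow x.1 P n

theorem eval_sum_le {ι : Type*} (s : Finset ι) (F : ι → L[X]) :
    x.eval (∑ i ∈ s, F i) ≤ ∑ i ∈ s, x.eval (F i) := by
  classical
  induction s using Finset.induction_on with
  | empty => simp [eval_zero]
  | insert i s hi ih =>
    rw [Finset.sum_insert hi, Finset.sum_insert hi]
    exact (x.eval_add_le _ _).trans (by gcongr)

variable {x} in
theorem ext_eval {y : BerkovichLine L} (h : ∀ P, x.eval P = y.eval P) : x = y :=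
  Subtype.ext (MulRingSeminorm.ext h)

theorem eval_le_sum (P : L[X]) :
    x.eval P ≤ ∑ i ∈ Finset.range (P.natDegree + 1), ‖P.coeff i‖ * x.eval X ^ i := by
  conv_lhs => rw [P.as_sum_range_C_mul_X_pow]
  refine (x.eval_sum_le _ _).trans (le_of_eq ?_)
  simp only [eval_mul, eval_C, eval_pow]

variable [IsUltrametricDist L]

theorem eval_natCast_le_one (n : ℕ) : x.eval (n : L[X]) ≤ 1 := by
  rw [← C_eq_natCast, eval_C]
  exact IsUltrametricDist.norm_natCast_le_one L n

/-- Only the triangle inequality is assumed of the seminorm. Integers have norm at most 1, so the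
binomial expansion bounds the n-th power of the left side by (n + 1) Mⁿ, and the linear factor is
negligible as n grows. -/
theorem eval_add_le_max (P Q : L[X]) : x.eval (P + Q) ≤ max (x.eval P) (x.eval Q) := by
  set M := max (x.eval P) (x.eval Q) with hM
  have hM0 : 0 ≤ M := (x.eval_nonneg P).trans (le_max_left _ _)
  have key : ∀ n : ℕ, x.eval (P + Q) ^ n ≤ (n + 1) * M ^ n := fun n => by
    rw [← eval_pow, add_pow]
    refine (x.eval_sum_le _ _).trans ?_
    calc _ ≤ ∑ i ∈ Finset.range (n + 1), M ^ n := Finset.sum_le_sum fun i hi => by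
          rw [eval_mul, eval_mul, eval_pow, eval_pow]
          have hi : i ≤ n := Nat.lt_succ_iff.1 (Finset.mem_range.1 hi)
          calc _ ≤ M ^ i * M ^ (n - i) * 1 := by
                have hP := x.eval_nonneg P
                have hQ := x.eval_nonneg Q
                gcongr
                · exact x.eval_nonneg _
                · exact le_max_left _ _
                · exact le_max_right _ _
                · exact x.eval_natCast_le_one _
            _ = M ^ n := by rw [mul_one, ← pow_add, Nat.add_sub_cancel' hi]
      _ = _ := by simp
  refine le_of_forall_gt_imp_ge_of_dense fun a ha => ?_
  by_contra! hlt
  have ha0 : 0 < a := hM0.trans_lt ha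
  obtain ⟨m, hm⟩ := Real.exists_natCast_add_one_lt_pow_of_one_lt
    (a := x.eval (P + Q) / a) ((one_lt_div ha0).2 hlt)
  rw [div_pow, lt_div_iff₀ (by positivity)] at hm
  have h1 := hm.trans_le (key m)
  have h2 : M ^ m ≤ a ^ m := by gcongr
  nlinarith [mul_le_mul_of_nonneg_left h2 (by positivity : (0 : ℝ) ≤ m + 1)]

theorem eval_add_eq_of_lt {P Q : L[X]} (h : x.eval Q < x.eval P) : x.eval (P + Q) = x.eval P := by
  refine le_antisymm ((x.eval_add_le_max P Q).trans (max_le le_rfl h.le)) ?_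
  have h1 := x.eval_add_le_max (P + Q) (-Q)
  rw [add_neg_cancel_right, eval_neg] at h1
  exact (le_max_iff.1 h1).resolve_right (not_le.2 h)

theorem eval_diskPoint_X_sub_C (a b : L) (r : {r : ℝ // 0 < r}) :
    (diskPoint a r).eval (X - C b) = max ‖a - b‖ r := by
  have hna : IsNonarchimedean (NormedField.toAbsoluteValue L) := IsUltrametricDist.norm_add_le_max
  have h : (diskPoint a r).eval (X - C b)
      = (taylor a (X - C b)).gaussNorm (NormedField.toAbsoluteValue L) r := rfl
  have hT : taylor a (X - C b) = X + C (a - b) := by simp [taylor_X, taylor_C]; ring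
  rw [h, hT]
  refine le_antisymm ?_ (max_le ?_ ?_)
  · obtain ⟨i, hi⟩ := exists_eq_gaussNorm (NormedField.toAbsoluteValue L) (r : ℝ) (X + C (a - b))
    rw [hi]
    rcases i with _ | _ | i
    · simp [NormedField.toAbsoluteValue]
    · simp [NormedField.toAbsoluteValue]
    · simp [coeff_X, r.2.le]
  · have h := le_gaussNorm (NormedField.toAbsoluteValue L) (X + C (a - b)) r.2.le 0
    rwa [coeff_add, coeff_X_zero, coeff_C_zero, zero_add, pow_zero, mul_one] at h
  · have h := le_gaussNorm (NormedField.toAbsoluteValue L) (X + C (a - b)) r.2.le 1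
    rwa [coeff_add, coeff_X_one, coeff_C_succ, add_zero, pow_one, map_one, one_mul] at h

theorem norm_eval_le_eval_diskPoint (a : L) (r : {r : ℝ // 0 < r}) (P : L[X]) :
    ‖P.eval a‖ ≤ (diskPoint a r).eval P := by
  have h : (diskPoint a r).eval P
      = (taylor a P).gaussNorm (NormedField.toAbsoluteValue L) r := rfl
  rw [h]
  simpa [NormedField.toAbsoluteValue, taylor_coeff_zero] using
    le_gaussNorm (NormedField.toAbsoluteValue L) (taylor a P) r.2.le 0

end Seminorm

section Topology

theorem continuous_eval (P : L[X]) : Continuous fun x : BerkovichLine L => x.eval P :=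
  (continuous_apply P).comp continuous_induced_dom

/-- The seminorm axioms are closed conditions in the product. Tychonoff then makes disks compact,
hence the line locally compact, as the Riesz representation theorem requires. -/
theorem isClosedEmbedding_eval :
    IsClosedEmbedding fun (x : BerkovichLine L) (P : L[X]) => x.eval P := by
  refine ⟨⟨⟨rfl⟩, fun x y h => ext_eval (congrFun h)⟩, ?_⟩
  have hr : Set.range (fun (x : BerkovichLine L) (P : L[X]) => x.eval P) =
      {F : L[X] → ℝ | F 0 = 0} ∩ {F | F 1 = 1} ∩ {F | ∀ P Q, F (P + Q) ≤ F P + F Q} ∩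
        {F | ∀ P, F (-P) = F P} ∩ {F | ∀ P Q, F (P * Q) = F P * F Q} ∩
        {F | ∀ a, F (C a) = ‖a‖} := by
    ext F
    constructor
    · rintro ⟨x, rfl⟩
      exact ⟨⟨⟨⟨⟨x.eval_zero, x.eval_one⟩, x.eval_add_le⟩, x.eval_neg⟩, x.eval_mul⟩, x.eval_C⟩
    · rintro ⟨⟨⟨⟨⟨h0, h1⟩, ha⟩, hn⟩, hm⟩, hC⟩
      exact ⟨⟨{ toFun := F, map_zero' := h0, add_le' := ha, neg' := hn, map_one' := h1,
                map_mul' := hm }, hC⟩, rfl⟩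
  rw [hr]
  refine ((((IsClosed.inter ?_ ?_).inter ?_).inter ?_).inter ?_).inter ?_
  · exact isClosed_eq (continuous_apply _) continuous_const
  · exact isClosed_eq (continuous_apply _) continuous_const
  · simp only [Set.ofPred_forall]
    exact isClosed_iInter fun P => isClosed_iInter fun Q => isClosed_le (continuous_apply _)
      ((continuous_apply P).add (continuous_apply Q))
  · simp only [Set.ofPred_forall]
    exact isClosed_iInter fun P => isClosed_eq (continuous_apply _) (continuous_apply _)
  · simp only [Set.ofPred_forall]
    exact isClosed_iInter fun P => isClosed_iInter fun Q => isClosed_eq (continuous_apply _)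
      ((continuous_apply P).mul (continuous_apply Q))
  · simp only [Set.ofPred_forall]
    exact isClosed_iInter fun P => isClosed_eq (continuous_apply _) continuous_const

instance : T2Space (BerkovichLine L) := isClosedEmbedding_eval.isEmbedding.t2Space

theorem isCompact_setOf_eval_X_le (R : ℝ) : IsCompact {x : BerkovichLine L | x.eval X ≤ R} := by
  have h1 : IsCompact (Set.univ.pi fun P : L[X] => Set.Icc (0 : ℝ)
      (∑ i ∈ Finset.range (P.natDegree + 1), ‖P.coeff i‖ * R ^ i)) :=
    isCompact_univ_pi fun P => isCompact_Icc
  refine (isClosedEmbedding_eval.isCompact_preimage h1).of_isClosed_subset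
    (isClosed_le (continuous_eval X) continuous_const) fun x hx P _ => ?_
  refine ⟨x.eval_nonneg P, (x.eval_le_sum P).trans (Finset.sum_le_sum fun i _ => ?_)⟩
  have := x.eval_nonneg X
  have hx : x.eval X ≤ R := hx
  gcongr

instance : LocallyCompactSpace (BerkovichLine L) := by
  have : WeaklyLocallyCompactSpace (BerkovichLine L) := ⟨fun x =>
    ⟨{y | y.eval X ≤ x.eval X + 1}, isCompact_setOf_eval_X_le _, by
      filter_upwards [(continuous_eval X).continuousAt.eventually_lt
        (continuousAt_const (y := x.eval X + 1)) (lt_add_one _)] with y hy using hy.le⟩⟩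
  infer_instance

theorem continuous_diskPotential (a : L) (r : {r : ℝ // 0 < r}) :
    Continuous (diskPotential a r) :=
  Continuous.log ((continuous_eval _).max continuous_const)
    fun _ => (r.2.trans_le (le_max_right _ _)).ne'

variable [IsUltrametricDist L]

theorem eval_X_sub_C_eq (x : BerkovichLine L) {a : L} (h : ‖a‖ < x.eval X) :
    x.eval (X - C a) = x.eval X := by
  rw [sub_eq_add_neg]
  exact x.eval_add_eq_of_lt (by rwa [eval_neg, eval_C])

theorem diskPotential_eq_log (x : BerkovichLine L) {a : L} {r : {r : ℝ // 0 < r}}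
    (ha : ‖a‖ < x.eval X) (hr : r ≤ x.eval X) : diskPotential a r x = Real.log (x.eval X) := by
  rw [diskPotential, eval_X_sub_C_eq x ha, max_eq_left hr]

/-- Both sides are log max(|a - b|, r, s). This exchanges averaging over disk points with averaging
over potentials. -/
theorem diskPotential_diskPoint_comm (a b : L) (r s : {r : ℝ // 0 < r}) :
    diskPotential a r (diskPoint b s) = diskPotential b s (diskPoint a r) := by
  simp only [diskPotential, eval_diskPoint_X_sub_C, norm_sub_rev b a]
  congr 1
  rw [max_assoc, max_assoc, max_comm (s : ℝ)]

theorem hasCompactSupport_diskPotential_sub (a b : L) (r s : {r : ℝ // 0 < r}) :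
    HasCompactSupport fun x => diskPotential a r x - diskPotential b s x := by
  refine HasCompactSupport.intro (isCompact_setOf_eval_X_le (max (max ‖a‖ ‖b‖) (max r s)))
    fun x hx => ?_
  have hx : max (max ‖a‖ ‖b‖) (max (r : ℝ) s) < x.eval X := not_le.1 hx
  simp only [max_lt_iff] at hx
  rw [diskPotential_eq_log x hx.1.1 hx.2.1.le, diskPotential_eq_log x hx.1.2 hx.2.2.le, sub_self]

theorem integrable_diskPotential_sub (μ : Measure (BerkovichLine L)) [IsFiniteMeasure μ]
    (a b : L) (r s : {r : ℝ // 0 < r}) :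
    Integrable (fun x => diskPotential a r x - diskPotential b s x) μ :=
  ((continuous_diskPotential a r).sub (continuous_diskPotential b s)).integrable_of_hasCompactSupport
    (hasCompactSupport_diskPotential_sub a b r s)

end Topology

end BerkovichLine

/-! ### Escape rates -/

section EscapeRate

variable {L : Type*} [NormedField L]

theorem iterPoly_zero (c : L) : iterPoly c 0 = X := rfl

theorem iterPoly_succ (c : L) (n : ℕ) : iterPoly c (n + 1) = iterPoly c n ^ 2 + C c :=
  Function.iterate_succ_apply' _ _ _

theorem iterPoly_comp (c : L) (n : ℕ) : (iterPoly c n).comp (X ^ 2 + C c) = iterPoly c (n + 1) := by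
  induction n with
  | zero => simp [iterPoly_succ, iterPoly_zero]
  | succ n ih => rw [iterPoly_succ, add_comp, pow_comp, ih, C_comp, ← iterPoly_succ]

namespace BerkovichLine

/-- The action of `z ↦ z² + c` on the Berkovich line. -/
def quadMap (c : L) (x : BerkovichLine L) : BerkovichLine L :=
  ⟨{ toFun := fun P => x.eval (P.comp (X ^ 2 + C c))
     map_zero' := by simp [eval_zero]
     add_le' := fun P Q => by simpa using x.eval_add_le _ _
     neg' := fun P => by simp [eval_neg]
     map_one' := by simp [eval_one]
     map_mul' := fun P Q => by simp [eval_mul] },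
   fun a => show x.eval ((C a).comp (X ^ 2 + C c)) = ‖a‖ by rw [C_comp, BerkovichLine.eval_C]⟩

theorem eval_quadMap (c : L) (x : BerkovichLine L) (P : L[X]) :
    (quadMap c x).eval P = x.eval (P.comp (X ^ 2 + C c)) := rfl

theorem eval_X_iterate_quadMap (c : L) (n : ℕ) (x : BerkovichLine L) :
    ((quadMap c)^[n] x).eval X = x.eval (iterPoly c n) := by
  induction n generalizing x with
  | zero => rfl
  | succ n ih => rw [Function.iterate_succ_apply, ih, eval_quadMap, iterPoly_comp]

theorem quadMap_ofPoint (c z : L) : quadMap c (ofPoint z) = ofPoint (z ^ 2 + c) :=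
  ext_eval fun P => show ‖(P.comp (X ^ 2 + C c)).eval z‖ = ‖P.eval (z ^ 2 + c)‖ by simp [eval_comp]

theorem eval_X_ofPoint (z : L) : (ofPoint z).eval X = ‖z‖ :=
  show ‖(X : L[X]).eval z‖ = ‖z‖ by rw [eval_X]

end BerkovichLine

open BerkovichLine

/-- The `n`-th approximation `2⁻ⁿ log max(|f_c^n|_x, 1)` of the escape rate. -/
def escapeApprox (c : L) (n : ℕ) (x : BerkovichLine L) : ℝ :=
  (1 / 2 ^ n : ℝ) * Real.log (max (x.eval (iterPoly c n)) 1)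

theorem continuous_escapeApprox (c : L) (n : ℕ) : Continuous (escapeApprox c n) :=
  continuous_const.mul <| Continuous.log ((continuous_eval _).max continuous_const)
    fun _ => (one_pos.trans_le (le_max_right _ _)).ne'

theorem escapeApprox_nonneg (c : L) (n : ℕ) (x : BerkovichLine L) : 0 ≤ escapeApprox c n x :=
  mul_nonneg (by positivity) (Real.log_nonneg (le_max_right _ _))

theorem escapeApprox_quadMap (c : L) (n : ℕ) (x : BerkovichLine L) :
    escapeApprox c n (quadMap c x) = 2 * escapeApprox c (n + 1) x := by
  rw [escapeApprox, escapeApprox, eval_quadMap, iterPoly_comp, pow_succ]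
  field_simp

/-- A radius outside of which `z ↦ z² + c` is escaping. -/
def escapeRadius (c : L) : ℝ := max 1 √‖c‖

theorem one_le_escapeRadius (c : L) : 1 ≤ escapeRadius c := le_max_left _ _

theorem escapeRadius_pos (c : L) : 0 < escapeRadius c := one_pos.trans_le (one_le_escapeRadius c)

theorem norm_le_escapeRadius_sq (c : L) : ‖c‖ ≤ escapeRadius c ^ 2 := by
  have h : √‖c‖ ≤ escapeRadius c := le_max_right _ _
  calc ‖c‖ = √‖c‖ ^ 2 := (Real.sq_sqrt (norm_nonneg c)).symm
    _ ≤ _ := by gcongr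

variable [IsUltrametricDist L]

/-- Replacing max(|fⁿ|, 1)² by max(|fⁿ⁺¹|, 1) costs at most a factor max(|c|, 1) either way. The
bound is uniform in x, so the escape rate is a uniform limit of continuous functions. -/
theorem dist_escapeApprox_succ_le (c : L) (n : ℕ) (x : BerkovichLine L) :
    dist (escapeApprox c n x) (escapeApprox c (n + 1) x)
      ≤ Real.log (max ‖c‖ 1) / 2 / 2 ^ n := by
  set A := x.eval (iterPoly c n) with hA
  set B := x.eval (iterPoly c (n + 1)) with hB
  have hA0 : 0 ≤ A := x.eval_nonneg _
  set m := max A 1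
  set m' := max B 1
  set k := max ‖c‖ 1
  have hm1 : 1 ≤ m := le_max_right _ _
  have hm'1 : 1 ≤ m' := le_max_right _ _
  have hk1 : 1 ≤ k := le_max_right _ _
  have hck : ‖c‖ ≤ k := le_max_left _ _
  have h1 : m' ≤ m ^ 2 * k := by
    refine max_le ?_ (by nlinarith [one_le_pow₀ hm1 (n := 2)])
    rw [hB, iterPoly_succ]
    refine (x.eval_add_le_max _ _).trans (max_le ?_ ?_)
    · rw [BerkovichLine.eval_pow, ← hA]
      have : A ^ 2 ≤ m ^ 2 := by gcongr; exact le_max_left _ _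
      nlinarith [sq_nonneg m]
    · rw [BerkovichLine.eval_C]
      nlinarith [one_le_pow₀ hm1 (n := 2)]
  have h2 : m ^ 2 ≤ m' * k := by
    rcases le_total A 1 with h | h
    · have : m = 1 := max_eq_right h
      rw [this]; nlinarith
    · have : m = A := max_eq_left h
      have e : iterPoly c n ^ 2 = iterPoly c (n + 1) + -C c := by rw [iterPoly_succ]; ring
      rw [this, hA, ← BerkovichLine.eval_pow, e]
      refine (x.eval_add_le_max _ _).trans (max_le ?_ ?_)
      · have : B ≤ m' := le_max_left _ _
        nlinarith
      · rw [BerkovichLine.eval_neg, BerkovichLine.eval_C]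
        nlinarith
  have hm0 : 0 < m := by positivity
  have hm'0 : 0 < m' := by positivity
  have hk0 : 0 < k := by positivity
  have l1 := Real.log_le_log hm'0 h1
  have l2 := Real.log_le_log (by positivity) h2
  rw [Real.log_mul (by positivity) hk0.ne', Real.log_pow] at l1
  rw [Real.log_mul hm'0.ne' hk0.ne', Real.log_pow] at l2
  push_cast at l1 l2
  have e : escapeApprox c n x - escapeApprox c (n + 1) x
      = (2 * Real.log m - Real.log m') / 2 / 2 ^ n := by
    rw [escapeApprox, escapeApprox, pow_succ]
    simp only [m, m', A, B]
    field_simp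
  rw [Real.dist_eq, e, abs_div, abs_div, abs_of_pos (by positivity : (0 : ℝ) < 2 ^ n), abs_two]
  gcongr
  exact abs_le.2 ⟨by linarith, by linarith⟩

theorem tendsto_escapeApprox (c : L) (x : BerkovichLine L) :
    Tendsto (fun n => escapeApprox c n x) atTop (𝓝 (escapeRate c x)) :=
  (cauchySeq_of_le_geometric_two (dist_escapeApprox_succ_le c · x)).tendsto_limUnder

theorem dist_escapeApprox_le (c : L) (n : ℕ) (x : BerkovichLine L) :
    dist (escapeApprox c n x) (escapeRate c x) ≤ Real.log (max ‖c‖ 1) / 2 ^ n :=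
  dist_le_of_le_geometric_two_of_tendsto (dist_escapeApprox_succ_le c · x)
    (tendsto_escapeApprox c x) n

theorem tendstoUniformly_escapeApprox (c : L) :
    TendstoUniformly (escapeApprox c) (escapeRate c) atTop := by
  have h : Tendsto (fun n : ℕ => Real.log (max ‖c‖ 1) / 2 ^ n) atTop (𝓝 0) :=
    tendsto_const_nhds.div_atTop (tendsto_pow_atTop_atTop_of_one_lt one_lt_two)
  refine Metric.tendstoUniformly_iff.2 fun ε hε => ?_
  filter_upwards [h.eventually_lt_const hε] with n hn x
  rw [dist_comm]
  exact (dist_escapeApprox_le c n x).trans_lt hn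

theorem continuous_escapeRate (c : L) : Continuous (escapeRate c) :=
  (tendstoUniformly_escapeApprox c).continuous
    (Frequently.of_forall (continuous_escapeApprox c))

theorem escapeRate_nonneg (c : L) (x : BerkovichLine L) : 0 ≤ escapeRate c x :=
  ge_of_tendsto' (tendsto_escapeApprox c x) fun n => escapeApprox_nonneg c n x

theorem escapeRate_quadMap (c : L) (x : BerkovichLine L) :
    escapeRate c (quadMap c x) = 2 * escapeRate c x := by
  refine tendsto_nhds_unique (tendsto_escapeApprox c (quadMap c x)) ?_
  simp only [escapeApprox_quadMap]
  exact ((tendsto_escapeApprox c x).comp (tendsto_add_atTop_nat 1)).const_mul 2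

theorem escapeRate_le_log (c : L) (x : BerkovichLine L) {M : ℝ} (hM : escapeRadius c ≤ M) :
    escapeRate c x ≤ Real.log (max (x.eval X) M) := by
  have hM1 : 1 ≤ M := (one_le_escapeRadius c).trans hM
  set t := max (x.eval X) M
  have ht : M ≤ t := le_max_right _ _
  have ht1 : 1 ≤ t := hM1.trans ht
  have hx := x.eval_nonneg
  have key : ∀ n, x.eval (iterPoly c n) ≤ t ^ 2 ^ n := fun n => by
    induction n with
    | zero => rw [pow_zero, pow_one]; exact le_max_left _ _
    | succ n ih =>
      rw [iterPoly_succ]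
      refine (x.eval_add_le_max _ _).trans (max_le ?_ ?_)
      · rw [BerkovichLine.eval_pow, pow_succ 2 n, pow_mul]
        gcongr
        exact hx _
      · rw [BerkovichLine.eval_C]
        refine (norm_le_escapeRadius_sq c).trans ?_
        calc escapeRadius c ^ 2 ≤ t ^ 2 := by
              gcongr
              · exact (escapeRadius_pos c).le
              · exact hM.trans ht
          _ ≤ t ^ 2 ^ (n + 1) := by
              exact pow_le_pow_right₀ ht1 (le_self_pow₀ (by norm_num) (by omega))
  refine le_of_tendsto' (tendsto_escapeApprox c x) fun n => ?_
  have h1 : Real.log (max (x.eval (iterPoly c n)) 1) ≤ 2 ^ n * Real.log t := by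
    have := Real.log_le_log (by positivity) (max_le (key n) (one_le_pow₀ ht1))
    rwa [Real.log_pow, Nat.cast_pow, Nat.cast_ofNat] at this
  rw [escapeApprox, one_div, inv_mul_le_iff₀ (by positivity)]
  exact h1

/-- Outside the escape radius the square strictly dominates c at every iteration, so |fⁿ| is exactly
|X| to the power 2ⁿ. -/
theorem escapeRate_eq_log (c : L) (x : BerkovichLine L) (h : escapeRadius c < x.eval X) :
    escapeRate c x = Real.log (x.eval X) := by
  set t := x.eval X with ht
  have ht1 : 1 < t := (one_le_escapeRadius c).trans_lt h
  have hc : ‖c‖ < t ^ 2 := (norm_le_escapeRadius_sq c).trans_lt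
    (by gcongr; exact (escapeRadius_pos c).le)
  have key : ∀ n, x.eval (iterPoly c n) = t ^ 2 ^ n := fun n => by
    induction n with
    | zero => rw [pow_zero, pow_one]; rfl
    | succ n ih =>
      have e : x.eval (iterPoly c n ^ 2) = t ^ 2 ^ (n + 1) := by
        rw [BerkovichLine.eval_pow, ih, ← pow_mul, ← pow_succ]
      rw [iterPoly_succ, x.eval_add_eq_of_lt, e]
      rw [e, BerkovichLine.eval_C]
      refine hc.trans_le ?_
      exact pow_le_pow_right₀ ht1.le (le_self_pow₀ (by norm_num) (by omega))
  refine tendsto_nhds_unique (tendsto_escapeApprox c x) (tendsto_const_nhds.congr fun n => ?_)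
  rw [escapeApprox, key, max_eq_left (one_le_pow₀ ht1.le), Real.log_pow]
  push_cast
  field_simp

theorem escapeRate_ofPoint_le (c a : L) (r : {r : ℝ // 0 < r}) :
    escapeRate c (ofPoint a) ≤ escapeRate c (diskPoint a r) :=
  le_of_tendsto_of_tendsto' (tendsto_escapeApprox c _) (tendsto_escapeApprox c _) fun n =>
    mul_le_mul_of_nonneg_left (Real.log_le_log (one_pos.trans_le (le_max_right _ _))
      (max_le_max_right _ (norm_eval_le_eval_diskPoint a r _))) (by positivity)

/-- The escape rate at a point of `L`. -/
def pointRate (c z : L) : ℝ := escapeRate c (ofPoint z)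

theorem pointRate_nonneg (c z : L) : 0 ≤ pointRate c z := escapeRate_nonneg c _

theorem pointRate_eq_half (c z : L) : pointRate c z = pointRate c (z ^ 2 + c) / 2 := by
  rw [pointRate, pointRate, ← quadMap_ofPoint, escapeRate_quadMap]
  ring

theorem pointRate_eq_log {c z : L} (h : escapeRadius c < ‖z‖) : pointRate c z = Real.log ‖z‖ := by
  rw [pointRate, escapeRate_eq_log c _ (by rwa [eval_X_ofPoint]), eval_X_ofPoint]

end EscapeRate

/-! ### Averages over preimages of disks -/

section Preimages

open BerkovichLine

variable {L : Type*} [NormedField L]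

/-- A square root of `u`, if there is one. -/
def squareRoot (u : L) : L := Classical.epsilon fun w => w ^ 2 = u

theorem squareRoot_sq (hsq : ∀ u : L, ∃ w, w ^ 2 = u) (u : L) : squareRoot u ^ 2 = u :=
  Classical.epsilon_spec (hsq u)

/-- The radius of the components of the preimage under `z ↦ z²` of the disk with centre `w²` and
radius `r`, in residue characteristic other than `2`. -/
def preimageRadius (w : L) (r : {r : ℝ // 0 < r}) : {r : ℝ // 0 < r} :=
  ⟨r / max ‖w‖ √r, div_pos r.2 (lt_max_of_lt_right (Real.sqrt_pos.2 r.2))⟩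

/-- The average of a function of disks over the preimages of a disk under `z ↦ z² + c`. -/
def preimageAvg (c : L) :
    Module.End ℝ (L × {r : ℝ // 0 < r} → ℝ) where
  toFun φ d := (φ (squareRoot (d.1 - c), preimageRadius (squareRoot (d.1 - c)) d.2) +
    φ (-squareRoot (d.1 - c), preimageRadius (squareRoot (d.1 - c)) d.2)) / 2
  map_add' φ ψ := by ext d; simp only [Pi.add_apply]; ring
  map_smul' a φ := by ext d; simp only [Pi.smul_apply, smul_eq_mul, RingHom.id_apply]; ring

theorem preimageAvg_apply (c : L) (φ : L × {r : ℝ // 0 < r} → ℝ) (d : L × {r : ℝ // 0 < r}) :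
    preimageAvg c φ d = (φ (squareRoot (d.1 - c), preimageRadius (squareRoot (d.1 - c)) d.2) +
    φ (-squareRoot (d.1 - c), preimageRadius (squareRoot (d.1 - c)) d.2)) / 2 := rfl

theorem preimageAvg_const (c : L) (m : ℝ) (n : ℕ) :
    (preimageAvg c ^ n) (fun _ => m) = fun _ => m := by
  induction n with
  | zero => rfl
  | succ n ih =>
    rw [pow_succ, Module.End.mul_apply]
    have : preimageAvg c (fun _ => m) = fun _ => m := by ext d; rw [preimageAvg_apply]; ring
    rw [this, ih]

/-- A set of disks that contains all preimages under `z ↦ z² + c` of its members. -/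
def smallDisks (c : L) : Set (L × {r : ℝ // 0 < r}) :=
  {d | ‖d.1‖ ≤ escapeRadius c ∧ d.2 ≤ escapeRadius c}

theorem unitDisk_mem_smallDisks (c : L) : ((0, ⟨1, one_pos⟩) : L × {r : ℝ // 0 < r}) ∈ smallDisks c :=
  ⟨by simpa using (escapeRadius_pos c).le, one_le_escapeRadius c⟩

variable [IsUltrametricDist L]

theorem norm_squareRoot_le (hsq : ∀ u : L, ∃ w, w ^ 2 = u) {b c : L} (hb : ‖b‖ ≤ escapeRadius c) :
    ‖squareRoot (b - c)‖ ≤ escapeRadius c := by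
  have h1 := one_le_escapeRadius c
  refine le_of_sq_le_sq ?_ (by positivity)
  rw [← norm_pow, squareRoot_sq hsq]
  exact IsUltrametricDist.norm_sub_le_of_le (hb.trans (le_self_pow₀ h1 two_ne_zero))
    (norm_le_escapeRadius_sq c)

/-- With R the escape radius, |w|² ≤ max(|b|, |c|) ≤ R², and the new radius is at most √r ≤ R since
R ≥ 1. -/
theorem preimage_mem_smallDisks (hsq : ∀ u : L, ∃ w, w ^ 2 = u) (c : L)
    {d : L × {r : ℝ // 0 < r}} (hd : d ∈ smallDisks c) :
    (squareRoot (d.1 - c), preimageRadius (squareRoot (d.1 - c)) d.2) ∈ smallDisks c ∧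
    (-squareRoot (d.1 - c), preimageRadius (squareRoot (d.1 - c)) d.2) ∈ smallDisks c := by
  have h1 := one_le_escapeRadius c
  have hw := norm_squareRoot_le hsq hd.1
  have hs : (preimageRadius (squareRoot (d.1 - c)) d.2 : ℝ) ≤ escapeRadius c := by
    have hr := d.2.2
    have hsr := Real.sqrt_pos.2 hr
    calc (d.2 : ℝ) / max ‖squareRoot (d.1 - c)‖ √d.2 ≤ d.2 / √d.2 := by
          gcongr; exact le_max_right _ _
      _ = √d.2 := Real.div_sqrt
      _ ≤ √(escapeRadius c) := Real.sqrt_le_sqrt hd.2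
      _ ≤ escapeRadius c := (Real.sqrt_le_left (by positivity)).2 (le_self_pow₀ h1 two_ne_zero)
  exact ⟨⟨hw, hs⟩, by simpa using hw, hs⟩

theorem preimageAvg_pow_nonneg (hsq : ∀ u : L, ∃ w, w ^ 2 = u) (c : L) (n : ℕ)
    {φ : L × {r : ℝ // 0 < r} → ℝ} (h : ∀ d ∈ smallDisks c, 0 ≤ φ d) :
    ∀ d ∈ smallDisks c, 0 ≤ (preimageAvg c ^ n) φ d := by
  induction n with
  | zero => exact h
  | succ n ih =>
    intro d hd
    rw [pow_succ', Module.End.mul_apply, preimageAvg_apply]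
    have := preimage_mem_smallDisks hsq c hd
    have h1 := ih _ this.1
    have h2 := ih _ this.2
    positivity

theorem preimageAvg_pow_mono (hsq : ∀ u : L, ∃ w, w ^ 2 = u) (c : L) (n : ℕ)
    {φ ψ : L × {r : ℝ // 0 < r} → ℝ} (h : ∀ d ∈ smallDisks c, φ d ≤ ψ d)
    {d : L × {r : ℝ // 0 < r}} (hd : d ∈ smallDisks c) :
    (preimageAvg c ^ n) φ d ≤ (preimageAvg c ^ n) ψ d := by
  have := preimageAvg_pow_nonneg hsq c n (φ := ψ - φ) (fun d hd => sub_nonneg.2 (h d hd)) d hd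
  rw [map_sub] at this
  exact sub_nonneg.1 this

/-- Applied to A = |X - w|, B = |X + w|, t = |2w| = |w|. The hypotheses say that the two largest of
A, B, t agree. If t ≤ √r, the two preimages are one disk of radius √r; otherwise they are disjoint
disks of radius r / t. -/
theorem max_mul_eq_of_isosceles {A B t r : ℝ} (hA : 0 ≤ A) (hB : 0 ≤ B) (hr : 0 < r)
    (h1 : A ≤ max B t) (h2 : B ≤ max A t) (h3 : t ≤ max A B) :
    max (A * B) r = max A (r / max t √r) * max B (r / max t √r) := by
  have hs := Real.sqrt_pos.2 hr
  have hss := Real.mul_self_sqrt hr.le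
  wlog hAB : B ≤ A generalizing A B
  · rw [mul_comm A B, mul_comm (max A _)]
    exact this hB hA h2 h1 (by rwa [max_comm]) (le_of_not_ge hAB)
  rw [max_eq_left hAB] at h3
  rcases le_or_gt t √r with htr | htr
  · rw [max_eq_right htr, Real.div_sqrt]
    rcases le_or_gt A √r with h | h
    · rw [max_eq_right h, max_eq_right (hAB.trans h), hss, max_eq_right]
      nlinarith
    · have : B = A := by
        refine le_antisymm hAB ?_
        rcases le_max_iff.1 h1 with h' | h'
        · exact h'
        · linarith
      subst this
      rw [max_eq_left h.le, max_eq_left]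
      nlinarith
  · have ht0 : 0 < t := hs.trans htr
    have hrt : r / t < √r := by rw [div_lt_iff₀ ht0]; nlinarith
    rw [max_eq_left htr.le, max_eq_left (a := A) (by linarith)]
    rw [mul_max_of_nonneg _ _ hA]
    rcases h3.eq_or_lt with h | h
    · rw [← h, mul_div_cancel₀ _ ht0.ne']
    · have : B = A := by
        refine le_antisymm hAB ?_
        rcases le_max_iff.1 h1 with h' | h'
        · exact h'
        · linarith
      subst this
      rw [max_eq_left, max_eq_left]
      · gcongr
        linarith
      · nlinarith

theorem diskPotential_quadMap (hsq : ∀ u : L, ∃ w, w ^ 2 = u) (h2 : ‖(2 : L)‖ = 1) (c b : L)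
    (r : {r : ℝ // 0 < r}) (x : BerkovichLine L) :
    diskPotential b r (quadMap c x) =
      diskPotential (squareRoot (b - c)) (preimageRadius (squareRoot (b - c)) r) x +
      diskPotential (-squareRoot (b - c)) (preimageRadius (squareRoot (b - c)) r) x := by
  set w := squareRoot (b - c) with hw
  have hw2 : w ^ 2 = b - c := squareRoot_sq hsq _
  have hs := (preimageRadius w r).2
  simp only [diskPotential]
  rw [← Real.log_mul (hs.trans_le (le_max_right _ _)).ne' (hs.trans_le (le_max_right _ _)).ne']
  congr 1
  have e : (X - C b : L[X]).comp (X ^ 2 + C c) = (X - C w) * (X - C (-w)) := by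
    have : (C b : L[X]) = C w ^ 2 + C c := by rw [← C_pow, hw2, ← C_add]; congr 1; ring
    rw [sub_comp, X_comp, C_comp, this, C_neg]
    ring
  rw [eval_quadMap, e, BerkovichLine.eval_mul]
  have h2w : ‖w + w‖ = ‖w‖ := by rw [← two_mul, norm_mul, h2, one_mul]
  refine max_mul_eq_of_isosceles (x.eval_nonneg _) (x.eval_nonneg _) r.2 ?_ ?_ ?_
  · have : (X - C w : L[X]) = (X - C (-w)) + C (-(w + w)) := by simp only [C_neg, C_add]; ring
    rw [this]
    refine (x.eval_add_le_max _ _).trans (le_of_eq ?_)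
    rw [BerkovichLine.eval_C, norm_neg, h2w]
  · have : (X - C (-w) : L[X]) = (X - C w) + C (w + w) := by simp only [C_neg, C_add]; ring
    rw [this]
    refine (x.eval_add_le_max _ _).trans (le_of_eq ?_)
    rw [BerkovichLine.eval_C, h2w]
  · have : (C (w + w) : L[X]) = -(X - C w) + (X - C (-w)) := by simp only [C_neg, C_add]; ring
    rw [← h2w, ← x.eval_C, this]
    refine (x.eval_add_le_max _ _).trans (le_of_eq ?_)
    rw [BerkovichLine.eval_neg]

/-- On potentials, averaging over preimage disks is half of composition with the quadratic map. -/
theorem preimageAvg_pow_diskPotential (hsq : ∀ u : L, ∃ w, w ^ 2 = u) (h2 : ‖(2 : L)‖ = 1) (c : L)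
    (n : ℕ) (x : BerkovichLine L) :
    (preimageAvg c ^ n) (fun d => diskPotential d.1 d.2 x) =
      fun d => 1 / 2 ^ n * diskPotential d.1 d.2 ((quadMap c)^[n] x) := by
  induction n with
  | zero => ext d; simp
  | succ n ih =>
    ext d
    rw [pow_succ', Module.End.mul_apply, ih, preimageAvg_apply, Function.iterate_succ_apply',
      diskPotential_quadMap hsq h2, pow_succ]
    field_simp

theorem preimageAvg_pow_diskPotential_unitDisk (hsq : ∀ u : L, ∃ w, w ^ 2 = u)
    (h2 : ‖(2 : L)‖ = 1) (c : L) (n : ℕ) (x : BerkovichLine L) :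
    (preimageAvg c ^ n) (fun d => diskPotential d.1 d.2 x) (0, ⟨1, one_pos⟩) =
      escapeApprox c n x := by
  rw [preimageAvg_pow_diskPotential hsq h2, escapeApprox, ← eval_X_iterate_quadMap]
  simp [diskPotential]

end Preimages

/-! ### The canonical measure -/

section BoundedLimit

/-- A limit along a fixed ultrafilter. -/
def ultraLim (u : ℕ → ℝ) : ℝ := limUnder (hyperfilter ℕ : Filter ℕ) u

theorem tendsto_ultraLim {u : ℕ → ℝ} {B : ℝ} (h : ∀ n, |u n| ≤ B) :
    Tendsto u (hyperfilter ℕ : Filter ℕ) (𝓝 (ultraLim u)) := by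
  have hmem : Set.Icc (-B) B ∈ (hyperfilter ℕ).map u :=
    show u ⁻¹' Set.Icc (-B) B ∈ hyperfilter ℕ from Filter.univ_mem' fun n => abs_le.1 (h n)
  obtain ⟨x, -, hx⟩ := (isCompact_Icc (a := -B) (b := B)).ultrafilter_le_nhds' _ hmem
  exact tendsto_nhds_limUnder ⟨x, hx⟩

end BoundedLimit

section CanonicalMeasure

open BerkovichLine CompactlySupported

variable {L : Type*} [NormedField L] [IsUltrametricDist L]

theorem BerkovichLine.eval_X_diskPoint (a : L) (r : {r : ℝ // 0 < r}) :
    (diskPoint a r).eval X = max ‖a‖ r := by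
  simpa using eval_diskPoint_X_sub_C a 0 r

theorem abs_preimageAvg_pow_le (hsq : ∀ u : L, ∃ w, w ^ 2 = u) (c : L) (n : ℕ)
    {φ : L × {r : ℝ // 0 < r} → ℝ} {B : ℝ} (h : ∀ d, |φ d| ≤ B)
    {d : L × {r : ℝ // 0 < r}} (hd : d ∈ smallDisks c) :
    |(preimageAvg c ^ n) φ d| ≤ B := by
  rw [abs_le]
  constructor
  · simpa only [preimageAvg_const] using preimageAvg_pow_mono hsq c n (φ := fun _ => -B) (ψ := φ)
      (fun d _ => (abs_le.1 (h d)).1) hd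
  · simpa only [preimageAvg_const] using preimageAvg_pow_mono hsq c n (φ := φ) (ψ := fun _ => B)
      (fun d _ => (abs_le.1 (h d)).2) hd

/-- The mean of `φ` over the `n`-th preimages of the Gauss point under `z ↦ z² + c`. -/
def gaussPreimageMean (c : L) (n : ℕ) (φ : BerkovichLine L → ℝ) : ℝ :=
  (preimageAvg c ^ n) (fun d => φ (diskPoint d.1 d.2)) (0, ⟨1, one_pos⟩)

theorem gaussPreimageMean_add (c : L) (n : ℕ) (φ ψ : BerkovichLine L → ℝ) :
    gaussPreimageMean c n (φ + ψ) = gaussPreimageMean c n φ + gaussPreimageMean c n ψ :=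
  congrFun ((preimageAvg c ^ n).map_add _ _) _

theorem gaussPreimageMean_sub (c : L) (n : ℕ) (φ ψ : BerkovichLine L → ℝ) :
    gaussPreimageMean c n (φ - ψ) = gaussPreimageMean c n φ - gaussPreimageMean c n ψ :=
  congrFun ((preimageAvg c ^ n).map_sub _ _) _

theorem gaussPreimageMean_smul (c : L) (n : ℕ) (a : ℝ) (φ : BerkovichLine L → ℝ) :
    gaussPreimageMean c n (a • φ) = a * gaussPreimageMean c n φ :=
  congrFun ((preimageAvg c ^ n).map_smul a _) _

theorem gaussPreimageMean_diskPotential (hsq : ∀ u : L, ∃ w, w ^ 2 = u) (h2 : ‖(2 : L)‖ = 1)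
    (c : L) (n : ℕ) (a : L) (r : {r : ℝ // 0 < r}) :
    gaussPreimageMean c n (diskPotential a r) = escapeApprox c n (diskPoint a r) := by
  rw [← preimageAvg_pow_diskPotential_unitDisk hsq h2, gaussPreimageMean]
  simp only [diskPotential_diskPoint_comm a]

theorem tendsto_gaussPreimageMean (hsq : ∀ u : L, ∃ w, w ^ 2 = u) (c : L)
    (φ : C_c(BerkovichLine L, ℝ)) :
    Tendsto (fun n => gaussPreimageMean c n φ) (hyperfilter ℕ : Filter ℕ)
      (𝓝 (ultraLim fun n => gaussPreimageMean c n φ)) := by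
  obtain ⟨B, hB⟩ := φ.hasCompactSupport.exists_bound_of_continuous φ.continuous
  exact tendsto_ultraLim fun n =>
    abs_preimageAvg_pow_le hsq c n (fun d => hB _) (unitDisk_mem_smallDisks c)

/-- A limit of the uniform measures on the preimages of the Gauss point, as a functional. -/
def equilibriumFunctional (hsq : ∀ u : L, ∃ w, w ^ 2 = u) (c : L) :
    C_c(BerkovichLine L, ℝ) →ₚ[ℝ] ℝ :=
  PositiveLinearMap.mk₀
    { toFun := fun φ => ultraLim fun n => gaussPreimageMean c n φ
      map_add' := fun φ ψ => by
        refine Tendsto.limUnder_eq (((tendsto_gaussPreimageMean hsq c φ).add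
          (tendsto_gaussPreimageMean hsq c ψ)).congr fun n => ?_)
        rw [← gaussPreimageMean_add]
        rfl
      map_smul' := fun a φ => by
        refine Tendsto.limUnder_eq (((tendsto_gaussPreimageMean hsq c φ).const_mul a).congr
          fun n => ?_)
        rw [← gaussPreimageMean_smul]
        rfl }
    fun φ hφ => ge_of_tendsto' (tendsto_gaussPreimageMean hsq c φ) fun n =>
      preimageAvg_pow_nonneg hsq c n (fun d _ => hφ _) _ (unitDisk_mem_smallDisks c)

/-- On a potential the n-th preimage mean is, by symmetry, the n-th approximation of the escape rate
at the disk point, so there the limit is an ordinary one. The ultrafilter only supplies limits for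
the remaining test functions. -/
theorem hasLaplacian_rieszMeasure (hsq : ∀ u : L, ∃ w, w ^ 2 = u) (h2 : ‖(2 : L)‖ = 1) (c : L) :
    HasLaplacian (escapeRate c) (RealRMK.rieszMeasure (equilibriumFunctional hsq c)) := by
  intro a b r s
  let φ : C_c(BerkovichLine L, ℝ) :=
    ⟨⟨fun x => diskPotential a r x - diskPotential b s x,
      (continuous_diskPotential a r).sub (continuous_diskPotential b s)⟩,
      hasCompactSupport_diskPotential_sub a b r s⟩
  refine (RealRMK.integral_rieszMeasure (equilibriumFunctional hsq c) φ).trans ?_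
  refine tendsto_nhds_unique (tendsto_gaussPreimageMean hsq c φ) ?_
  have h : ∀ n, gaussPreimageMean c n φ =
      escapeApprox c n (diskPoint a r) - escapeApprox c n (diskPoint b s) := fun n => by
    rw [← gaussPreimageMean_diskPotential hsq h2, ← gaussPreimageMean_diskPotential hsq h2,
      ← gaussPreimageMean_sub]
    rfl
  simp only [h]
  exact ((tendsto_escapeApprox c _).sub (tendsto_escapeApprox c _)).mono_left
    Nat.hyperfilter_le_atTop

/-- The cutoff function with values in `[0, 1]` that is `1` on the disk of radius `r` and `0`
outside the disk of radius `e * r`. -/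
def cutoff (r : {r : ℝ // 0 < r}) (x : BerkovichLine L) : ℝ :=
  diskPotential 0 ⟨Real.exp 1 * r, mul_pos (Real.exp_pos 1) r.2⟩ x - diskPotential 0 r x

omit [IsUltrametricDist L] in
theorem cutoff_eq (r : {r : ℝ // 0 < r}) (x : BerkovichLine L) :
    cutoff r x = Real.log (max (x.eval X) (Real.exp 1 * r)) - Real.log (max (x.eval X) r) := by
  simp [cutoff, diskPotential]

theorem log_exp_one_mul {r : ℝ} (hr : 0 < r) : Real.log (Real.exp 1 * r) = 1 + Real.log r := by
  rw [Real.log_mul (Real.exp_pos 1).ne' hr.ne', Real.log_exp]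

omit [IsUltrametricDist L] in
theorem cutoff_eq_one {r : {r : ℝ // 0 < r}} {x : BerkovichLine L} (h : x.eval X ≤ r) :
    cutoff r x = 1 := by
  have : (r : ℝ) ≤ Real.exp 1 * r := le_mul_of_one_le_left r.2.le (Real.one_le_exp zero_le_one)
  rw [cutoff_eq, max_eq_right h, max_eq_right (h.trans this), log_exp_one_mul r.2]
  ring

omit [IsUltrametricDist L] in
theorem cutoff_lt_one {r : {r : ℝ // 0 < r}} {x : BerkovichLine L} (h : r < x.eval X) :
    cutoff r x < 1 := by
  have hx := r.2.trans h
  have h1 : (1 : ℝ) < Real.exp 1 := Real.one_lt_exp_iff.2 one_pos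
  rw [cutoff_eq, max_eq_left h.le, sub_lt_iff_lt_add, ← log_exp_one_mul hx]
  refine Real.log_lt_log (lt_max_of_lt_left hx) (max_lt ?_ ?_)
  · exact lt_mul_of_one_lt_left hx h1
  · gcongr

omit [IsUltrametricDist L] in
theorem cutoff_le_one (r : {r : ℝ // 0 < r}) (x : BerkovichLine L) : cutoff r x ≤ 1 :=
  (le_or_gt (x.eval X) r).elim (fun h => (cutoff_eq_one h).le) fun h => (cutoff_lt_one h).le

omit [IsUltrametricDist L] in
theorem cutoff_nonneg (r : {r : ℝ // 0 < r}) (x : BerkovichLine L) : 0 ≤ cutoff r x := by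
  rw [cutoff_eq, sub_nonneg]
  refine Real.log_le_log (lt_max_of_lt_right r.2) (max_le_max_left _ ?_)
  exact le_mul_of_one_le_left r.2.le (Real.one_le_exp zero_le_one)

theorem integrable_cutoff (μ : Measure (BerkovichLine L)) [IsFiniteMeasureOnCompacts μ]
    (r : {r : ℝ // 0 < r}) : Integrable (cutoff r) μ :=
  ((continuous_diskPotential _ _).sub
    (continuous_diskPotential _ _)).integrable_of_hasCompactSupport
    (hasCompactSupport_diskPotential_sub _ _ _ _)

theorem escapeRate_diskPoint_zero (c : L) {r : {r : ℝ // 0 < r}} (hr : escapeRadius c < r) :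
    escapeRate c (diskPoint 0 r) = Real.log r := by
  have h : (diskPoint (0 : L) r).eval X = r := by
    rw [eval_X_diskPoint, norm_zero, max_eq_right r.2.le]
  rw [escapeRate_eq_log c _ (by rwa [h]), h]

/-- Beyond the escape radius λ_c(ζ_{0,r}) = log r, which grows by 1 from r to e r. -/
theorem integral_cutoff {c : L} {μ : Measure (BerkovichLine L)}
    (hμ : HasLaplacian (escapeRate c) μ) {r : {r : ℝ // 0 < r}} (hr : escapeRadius c < r) :
    ∫ x, cutoff r x ∂μ = 1 := by
  have : (r : ℝ) ≤ Real.exp 1 * r := le_mul_of_one_le_left r.2.le (Real.one_le_exp zero_le_one)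
  refine (hμ 0 0 _ r).trans ?_
  rw [escapeRate_diskPoint_zero c hr, escapeRate_diskPoint_zero c (hr.trans_le this),
    log_exp_one_mul r.2]
  ring

/-- The cutoffs have integral 1. They dominate the indicators of an exhausting sequence of disks, so
the mass is at most 1; being at most 1 themselves, they force mass at least 1. -/
theorem isProbabilityMeasure_of_hasLaplacian {c : L} {μ : Measure (BerkovichLine L)}
    [IsFiniteMeasureOnCompacts μ] (hμ : HasLaplacian (escapeRate c) μ) :
    IsProbabilityMeasure μ := by
  have hpos : ∀ n : ℕ, 0 < escapeRadius c + 1 + n := fun n => by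
    have := escapeRadius_pos c; positivity
  let ρ : ℕ → {r : ℝ // 0 < r} := fun n => ⟨escapeRadius c + 1 + n, hpos n⟩
  have hρ : ∀ n, escapeRadius c < ρ n := fun n => by
    show escapeRadius c < escapeRadius c + 1 + n
    have : (0 : ℝ) ≤ n := n.cast_nonneg
    linarith
  let S : ℕ → Set (BerkovichLine L) := fun n => {x | x.eval X ≤ ρ n}
  have hSm : ∀ n, MeasurableSet (S n) := fun n =>
    (isClosed_le (continuous_eval X) continuous_const).measurableSet
  have hS : ∀ n, μ (S n) ≤ 1 := fun n => by
    have hfin : μ (S n) < ⊤ := (isCompact_setOf_eval_X_le _).measure_lt_top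
    have h1 : μ.real (S n) ≤ 1 := by
      rw [← integral_cutoff hμ (hρ n), ← integral_indicator_one (hSm n)]
      refine integral_mono ((integrable_indicator_iff (hSm n)).2
        (integrableOn_const hfin.ne)) (integrable_cutoff μ _) fun x => ?_
      by_cases hx : x ∈ S n
      · rw [Set.indicator_of_mem hx, cutoff_eq_one hx, Pi.one_apply]
      · rw [Set.indicator_of_notMem hx]
        exact cutoff_nonneg _ x
    rw [← ENNReal.ofReal_toReal hfin.ne]
    exact ENNReal.ofReal_le_one.2 h1
  have hmono : Monotone S := fun m n hmn x hx => le_trans (show x.eval X ≤ ρ m from hx) <| by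
    show escapeRadius c + 1 + (m : ℝ) ≤ escapeRadius c + 1 + n
    gcongr
  have hU : ⋃ n, S n = Set.univ := Set.eq_univ_of_forall fun x => by
    obtain ⟨n, hn⟩ := exists_nat_ge (x.eval X)
    refine Set.mem_iUnion.2 ⟨n, ?_⟩
    show x.eval X ≤ escapeRadius c + 1 + n
    linarith [escapeRadius_pos c]
  have hle : μ Set.univ ≤ 1 := by
    rw [← hU, hmono.measure_iUnion]
    exact iSup_le hS
  have : IsFiniteMeasure μ := ⟨hle.trans_lt ENNReal.one_lt_top⟩
  refine ⟨le_antisymm hle ?_⟩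
  have h1 : 1 ≤ μ.real Set.univ := by
    calc 1 = ∫ x, cutoff (ρ 0) x ∂μ := (integral_cutoff hμ (hρ 0)).symm
      _ ≤ ∫ _, 1 ∂μ := integral_mono (integrable_cutoff μ _) (integrable_const _) (cutoff_le_one _)
      _ = μ.real Set.univ := by simp
  rw [← ENNReal.ofReal_toReal (measure_ne_top μ Set.univ)]
  exact ENNReal.one_le_ofReal.2 h1

/-- Existence excludes the default value 0. Uniqueness is not needed: the energy bounds hold for
every probability measure with this Laplacian property. -/
theorem canonicalMeasure_spec (hsq : ∀ u : L, ∃ w, w ^ 2 = u) (h2 : ‖(2 : L)‖ = 1) (c : L) :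
    IsProbabilityMeasure (canonicalMeasure c) ∧
      HasLaplacian (escapeRate c) (canonicalMeasure c) := by
  have h : ∃ μ : Measure (BerkovichLine L),
      IsProbabilityMeasure μ ∧ HasLaplacian (escapeRate c) μ :=
    ⟨_, isProbabilityMeasure_of_hasLaplacian (hasLaplacian_rieszMeasure hsq h2 c),
      hasLaplacian_rieszMeasure hsq h2 c⟩
  rw [canonicalMeasure, dif_pos h]
  exact h.choose_spec

end CanonicalMeasure

/-! ### The energy as a limit of finite means -/

section Energy

open BerkovichLine

variable {L : Type*} [NormedField L] [IsUltrametricDist L]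
  {μ : Measure (BerkovichLine L)} [IsProbabilityMeasure μ] {c : L}

/-- A cutoff is at most 1 with mean 1, so it equals 1 almost everywhere; it is smaller than 1
outside its disk. -/
theorem ae_eval_X_le (hμ : HasLaplacian (escapeRate c) μ) :
    ∀ᵐ x ∂μ, x.eval X ≤ escapeRadius c + 1 := by
  have h0 : 0 < escapeRadius c + 1 := by linarith [escapeRadius_pos c]
  let r : {r : ℝ // 0 < r} := ⟨escapeRadius c + 1, h0⟩
  have hr : escapeRadius c < r := lt_add_one _
  have hint := integrable_cutoff μ r
  have hz : ∫ x, (1 - cutoff r x) ∂μ = 0 := by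
    rw [integral_sub (integrable_const _) hint, integral_cutoff hμ hr]
    simp
  rw [integral_eq_zero_iff_of_nonneg (fun x => sub_nonneg.2 (cutoff_le_one r x))
    ((integrable_const _).sub hint)] at hz
  filter_upwards [hz] with x hx
  by_contra! h
  have h1 : cutoff r x < 1 := cutoff_lt_one h
  have h2 : 1 - cutoff r x = 0 := hx
  linarith

/-- The Laplacian property only controls differences of potentials. Subtracting g_{0,r} with r
beyond the escape radius fixes the constant: it is almost everywhere log r, which is also
λ_c(ζ_{0,r}). -/
theorem integrable_and_integral_diskPotential (hμ : HasLaplacian (escapeRate c) μ) (a : L)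
    (s : {r : ℝ // 0 < r}) :
    Integrable (diskPotential a s) μ ∧
      ∫ x, diskPotential a s x ∂μ = escapeRate c (diskPoint a s) := by
  have h0 : 0 < escapeRadius c + 1 := by linarith [escapeRadius_pos c]
  let r : {r : ℝ // 0 < r} := ⟨escapeRadius c + 1, h0⟩
  have hr : escapeRadius c < r := lt_add_one _
  have hae : (fun x => (diskPotential a s x - diskPotential 0 r x) + Real.log r)
      =ᵐ[μ] diskPotential a s := by
    filter_upwards [ae_eval_X_le hμ] with x hx
    have : diskPotential 0 r x = Real.log r := by
      rw [diskPotential, C_0, sub_zero, max_eq_right hx]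
    rw [this]
    ring
  have hi := integrable_diskPotential_sub μ a 0 s r
  refine ⟨(hi.add (integrable_const _)).congr hae, ?_⟩
  rw [← integral_congr_ae hae, integral_add hi (integrable_const _), hμ,
    escapeRate_diskPoint_zero c hr]
  simp

theorem integrable_escapeRate (hμ : HasLaplacian (escapeRate c) μ) (c' : L) :
    Integrable (escapeRate c') μ := by
  refine Integrable.of_bound (continuous_escapeRate c').aestronglyMeasurable
    (Real.log (max (escapeRadius c + 1) (escapeRadius c'))) ?_
  filter_upwards [ae_eval_X_le hμ] with x hx
  rw [Real.norm_of_nonneg (escapeRate_nonneg c' x)]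
  exact (escapeRate_le_log c' x le_rfl).trans (Real.log_le_log
    (lt_max_of_lt_right (escapeRadius_pos c')) (max_le_max_right _ hx))

omit [IsUltrametricDist L] [IsProbabilityMeasure μ] in
theorem integrable_and_integral_preimageAvg_pow (c' : L) (n : ℕ)
    {g : BerkovichLine L → L × {r : ℝ // 0 < r} → ℝ} (hg : ∀ d, Integrable (fun x => g x d) μ)
    (d : L × {r : ℝ // 0 < r}) :
    Integrable (fun x => (preimageAvg c' ^ n) (g x) d) μ ∧
      ∫ x, (preimageAvg c' ^ n) (g x) d ∂μ =
        (preimageAvg c' ^ n) (fun d => ∫ x, g x d ∂μ) d := by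
  induction n generalizing d with
  | zero => exact ⟨hg d, rfl⟩
  | succ n ih =>
    simp only [pow_succ', Module.End.mul_apply, preimageAvg_apply _ ((preimageAvg c' ^ n) _)]
    have h1 := ih (squareRoot (d.1 - c'), preimageRadius (squareRoot (d.1 - c')) d.2)
    have h2 := ih (-squareRoot (d.1 - c'), preimageRadius (squareRoot (d.1 - c')) d.2)
    exact ⟨(h1.1.add h2.1).div_const 2, by
      rw [integral_div, integral_add h1.1 h2.1, h1.2, h2.2]⟩

/-- The n-th term is the integral of the n-th approximation of λ_{c'}: expand it as an average of
potentials and integrate each one. The uniform error bound gives convergence. -/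
theorem tendsto_preimageAvg_pow (hsq : ∀ u : L, ∃ w, w ^ 2 = u) (h2 : ‖(2 : L)‖ = 1)
    (hμ : HasLaplacian (escapeRate c) μ) (c' : L) :
    Tendsto (fun n => (preimageAvg c' ^ n) (fun d => escapeRate c (diskPoint d.1 d.2))
      (0, ⟨1, one_pos⟩)) atTop (𝓝 (∫ x, escapeRate c' x ∂μ)) := by
  have key : ∀ n, Integrable (escapeApprox c' n) μ ∧ ∫ x, escapeApprox c' n x ∂μ =
      (preimageAvg c' ^ n) (fun d => escapeRate c (diskPoint d.1 d.2)) (0, ⟨1, one_pos⟩) :=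
    fun n => by
      have := integrable_and_integral_preimageAvg_pow c' n
        (g := fun x d => diskPotential d.1 d.2 x)
        (fun d => (integrable_and_integral_diskPotential hμ d.1 d.2).1) (0, ⟨1, one_pos⟩)
      simp only [preimageAvg_pow_diskPotential_unitDisk hsq h2,
        (integrable_and_integral_diskPotential hμ _ _).2] at this
      exact this
  simp only [← (key _).2]
  have h : Tendsto (fun n : ℕ => Real.log (max ‖c'‖ 1) / 2 ^ n) atTop (𝓝 0) :=
    tendsto_const_nhds.div_atTop (tendsto_pow_atTop_atTop_of_one_lt one_lt_two)
  refine tendsto_iff_dist_tendsto_zero.2 (squeeze_zero (fun _ => dist_nonneg) (fun n => ?_) h)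
  rw [dist_eq_norm, ← integral_sub (key n).1 (integrable_escapeRate hμ c')]
  refine (norm_integral_le_of_norm_le_const (C := Real.log (max ‖c'‖ 1) / 2 ^ n)
    (ae_of_all _ fun x => ?_)).trans (by simp)
  rw [← dist_eq_norm]
  exact dist_escapeApprox_le c' n x

/-- The averaging operator is monotone and fixes constants, so a bound after k steps persists after
n + k. Passing from disks to their centres only lowers the escape rate. -/
theorem le_integral_escapeRate (hsq : ∀ u : L, ∃ w, w ^ 2 = u) (h2 : ‖(2 : L)‖ = 1)
    (hμ : HasLaplacian (escapeRate c) μ) (c' : L) (k : ℕ) {m : ℝ}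
    (h : ∀ d ∈ smallDisks c', m ≤ (preimageAvg c' ^ k) (fun d => pointRate c d.1) d) :
    m ≤ ∫ x, escapeRate c' x ∂μ := by
  refine ge_of_tendsto ((tendsto_preimageAvg_pow hsq h2 hμ c').comp (tendsto_add_atTop_nat k))
    (Eventually.of_forall fun n => ?_)
  rw [Function.comp_apply, pow_add, Module.End.mul_apply]
  simpa only [preimageAvg_const] using preimageAvg_pow_mono hsq c' n (φ := fun _ => m)
    (fun d hd => (h d hd).trans (preimageAvg_pow_mono hsq c' k
      (fun d _ => escapeRate_ofPoint_le c d.1 d.2) hd)) (unitDisk_mem_smallDisks c')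

theorem integral_escapeRate_le (hsq : ∀ u : L, ∃ w, w ^ 2 = u) (h2 : ‖(2 : L)‖ = 1)
    (hμ : HasLaplacian (escapeRate c) μ) (c' : L) :
    ∫ x, escapeRate c' x ∂μ ≤ Real.log (max (escapeRadius c') (escapeRadius c)) := by
  refine le_of_tendsto' (tendsto_preimageAvg_pow hsq h2 hμ c') fun n => ?_
  have := preimageAvg_pow_mono hsq c' n (φ := fun d => escapeRate c (diskPoint d.1 d.2))
    (ψ := fun _ => Real.log (max (escapeRadius c') (escapeRadius c)))
    (fun d hd => (escapeRate_le_log c _ le_rfl).trans ?_) (unitDisk_mem_smallDisks c')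
  · simpa only [preimageAvg_const] using this
  · refine Real.log_le_log (lt_max_of_lt_right (escapeRadius_pos c)) (max_le_max_right _ ?_)
    rw [eval_X_diskPoint]
    exact max_le hd.1 hd.2

end Energy

/-! ### Lower bounds for the energy -/

section LowerBounds

open BerkovichLine

variable {L : Type*} [NormedField L]

theorem le_preimageAvg (hsq : ∀ u : L, ∃ w, w ^ 2 = u) {c : L} {φ : L × {r : ℝ // 0 < r} → ℝ}
    {d : L × {r : ℝ // 0 < r}} {m : ℝ} (h : ∀ w s, w ^ 2 = d.1 - c → m ≤ φ (w, s)) :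
    m ≤ preimageAvg c φ d := by
  have hw := squareRoot_sq hsq (d.1 - c)
  rw [preimageAvg_apply]
  have h1 := h _ (preimageRadius (squareRoot (d.1 - c)) d.2) hw
  have h2 := h (-squareRoot (d.1 - c)) (preimageRadius (squareRoot (d.1 - c)) d.2)
    (by rw [neg_sq, hw])
  linarith

/-- For use when cancellation may spoil the estimate at one of the two square roots. -/
theorem half_le_preimageAvg (hsq : ∀ u : L, ∃ w, w ^ 2 = u) {c : L}
    {φ : L × {r : ℝ // 0 < r} → ℝ} (hφ : ∀ d, 0 ≤ φ d) {d : L × {r : ℝ // 0 < r}} {m : ℝ}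
    (h : ∀ w, w ^ 2 = d.1 - c → (∀ s, m ≤ φ (w, s)) ∨ ∀ s, m ≤ φ (-w, s)) :
    m / 2 ≤ preimageAvg c φ d := by
  rw [preimageAvg_apply]
  set s := preimageRadius (squareRoot (d.1 - c)) d.2
  have h1 := hφ (squareRoot (d.1 - c), s)
  have h2 := hφ (-squareRoot (d.1 - c), s)
  rcases h _ (squareRoot_sq hsq (d.1 - c)) with h' | h'
  · linarith [h' s]
  · linarith [h' s]

theorem preimageAvg_nonneg {c : L} {φ : L × {r : ℝ // 0 < r} → ℝ} (hφ : ∀ d, 0 ≤ φ d)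
    (d : L × {r : ℝ // 0 < r}) : 0 ≤ preimageAvg c φ d :=
  div_nonneg (add_nonneg (hφ _) (hφ _)) zero_le_two

theorem escapeRadius_eq {c : L} {s : ℝ} (hs : 1 < s) (hc : ‖c‖ = s ^ 2) : escapeRadius c = s := by
  rw [escapeRadius, hc, Real.sqrt_sq (by linarith), max_eq_right hs.le]

variable [IsUltrametricDist L]

theorem norm_eq_of_sq_eq_sub {c z w : L} {s : ℝ} (hs : 1 < s) (hc : ‖c‖ = s ^ 2) (hz : ‖z‖ ≤ s)
    (hw : w ^ 2 = z - c) : ‖w‖ = s := by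
  have h : ‖w‖ ^ 2 = s ^ 2 := by
    rw [← norm_pow, hw, ← norm_neg, neg_sub, sub_eq_add_neg, IsUltrametricDist.norm_add_eq_of_lt, hc]
    rw [norm_neg, hc]
    nlinarith
  exact (pow_left_inj₀ (norm_nonneg w) (by linarith) two_ne_zero).1 h

theorem le_norm_or_le_norm {a b : L} {t : ℝ} (h : t ≤ ‖a - b‖) : t ≤ ‖a‖ ∨ t ≤ ‖b‖ := by
  by_contra! h'
  have h1 := IsUltrametricDist.norm_add_le_max a (-b)
  rw [← sub_eq_add_neg, norm_neg] at h1
  exact absurd (h.trans h1) (not_le.2 (max_lt h'.1 h'.2))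

theorem le_norm_add_of_le {a b : L} {t u : ℝ} (ha : ‖a‖ ≤ t) (htu : t < u) (hb : u ≤ ‖b‖) :
    u ≤ ‖a + b‖ := by
  rw [add_comm, IsUltrametricDist.norm_add_eq_of_lt (ha.trans_lt (htu.trans_le hb))]
  exact hb

theorem log_le_pointRate {c z : L} {t : ℝ} (ht : escapeRadius c < t) (hz : t ≤ ‖z‖) :
    Real.log t ≤ pointRate c z := by
  rw [pointRate_eq_log (ht.trans_le hz)]
  exact Real.log_le_log ((escapeRadius_pos c).trans ht) hz

/-- For δ = c' - c and x over y over z under f_{c'}, f_c²(x) = (z - δ) + δ(δ - 2y). The second term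
dominates, and two steps cost a factor 4. -/
theorem log_le_pointRate_two {c c' z y x : L} {t : ℝ} (hy : y ^ 2 = z - c') (hx : x ^ 2 = y - c')
    (hz : ‖z - (c' - c)‖ ≤ escapeRadius c) (ht : escapeRadius c < t)
    (h : t ≤ ‖(c' - c) * ((c' - c) - 2 * y)‖) : Real.log t / 4 ≤ pointRate c x := by
  have e : (x ^ 2 + c) ^ 2 + c = (z - (c' - c)) + (c' - c) * ((c' - c) - 2 * y) := by
    rw [hx]
    linear_combination hy
  have h1 := log_le_pointRate ht (le_norm_add_of_le hz ht h)
  rw [← e] at h1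
  rw [pointRate_eq_half, pointRate_eq_half]
  linarith

/-- Here f_c²(p₀) = p₂ + ε, so one further step gives (p₃ - δ) + ε(ε + 2p₂) with δ = c' - c. -/
theorem log_le_pointRate_three {c c' p₃ p₂ p₁ p₀ ε : L} {t : ℝ} (h₂ : p₂ ^ 2 = p₃ - c')
    (h₁ : p₁ ^ 2 = p₂ - c') (h₀ : p₀ ^ 2 = p₁ - c') (hε : ε = (c' - c) * ((c' - c) - 1 - 2 * p₁))
    (hz : ‖p₃ - (c' - c)‖ ≤ escapeRadius c) (ht : escapeRadius c < t)
    (h : t ≤ ‖ε * (ε + 2 * p₂)‖) : Real.log t / 8 ≤ pointRate c p₀ := by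
  have e2 : (p₀ ^ 2 + c) ^ 2 + c = p₂ + ε := by
    rw [h₀, hε]
    linear_combination h₁
  have e3 : ((p₀ ^ 2 + c) ^ 2 + c) ^ 2 + c = (p₃ - (c' - c)) + ε * (ε + 2 * p₂) := by
    rw [e2]
    linear_combination h₂
  have h1 := log_le_pointRate ht (le_norm_add_of_le hz ht h)
  rw [← e3] at h1
  rw [pointRate_eq_half, pointRate_eq_half, pointRate_eq_half]
  linarith

variable {μ : Measure (BerkovichLine L)} [IsProbabilityMeasure μ] {c c' : L}

/-- Each z in the disk has |z| < √|c|, so |z² + c| = |c| is already beyond the escape radius of f_c.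
-/
theorem half_log_le_integral_of_norm_lt (hsq : ∀ u : L, ∃ w, w ^ 2 = u) (h2 : ‖(2 : L)‖ = 1)
    (hμ : HasLaplacian (escapeRate c) μ) (hc : 1 < ‖c‖) (h : ‖c'‖ < ‖c‖) :
    Real.log ‖c‖ / 2 ≤ ∫ x, escapeRate c' x ∂μ := by
  refine le_integral_escapeRate hsq h2 hμ c' 0 fun d hd => ?_
  have hs : 1 < √‖c‖ := by rwa [Real.lt_sqrt zero_le_one, one_pow]
  have hd1 : ‖d.1‖ < √‖c‖ :=
    hd.1.trans_lt (max_lt hs (Real.sqrt_lt_sqrt (norm_nonneg _) h))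
  have hsq' := Real.sq_sqrt (norm_nonneg c)
  have h1 : ‖d.1 ^ 2 + c‖ = ‖c‖ := by
    rw [add_comm, IsUltrametricDist.norm_add_eq_of_lt]
    rw [norm_pow]
    nlinarith [norm_nonneg d.1]
  have h3 : escapeRadius c < ‖c‖ := by
    rw [escapeRadius_eq hs hsq'.symm]
    nlinarith
  show Real.log ‖c‖ / 2 ≤ pointRate c d.1
  rw [pointRate_eq_half, pointRate_eq_log (by rwa [h1]), h1]

/-- Every first preimage has absolute value √|c'|, beyond the escape radius of f_c. -/
theorem half_log_le_integral_of_norm_gt (hsq : ∀ u : L, ∃ w, w ^ 2 = u) (h2 : ‖(2 : L)‖ = 1)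
    (hμ : HasLaplacian (escapeRate c) μ) (hc : 1 < ‖c'‖) (h : ‖c‖ < ‖c'‖) :
    Real.log ‖c'‖ / 2 ≤ ∫ x, escapeRate c' x ∂μ := by
  have hs : 1 < √‖c'‖ := by rwa [Real.lt_sqrt zero_le_one, one_pow]
  have hs2 := Real.sq_sqrt (norm_nonneg c')
  refine le_integral_escapeRate hsq h2 hμ c' 1 fun d hd => ?_
  rw [pow_one]
  refine le_preimageAvg hsq fun w s hw => ?_
  have hd1 : ‖d.1‖ ≤ √‖c'‖ := by
    rw [← escapeRadius_eq hs hs2.symm]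
    exact hd.1
  have hw1 := norm_eq_of_sq_eq_sub hs hs2.symm hd1 hw
  rw [← Real.log_sqrt (norm_nonneg c')]
  exact log_le_pointRate (max_lt hs (Real.sqrt_lt_sqrt (norm_nonneg _) h)) hw1.ge

variable {s : ℝ}

theorem half_log_le_integral_of_lt_norm_sub (hsq : ∀ u : L, ∃ w, w ^ 2 = u) (h2 : ‖(2 : L)‖ = 1)
    (hμ : HasLaplacian (escapeRate c) μ) (hs : 1 < s) (hc : ‖c‖ = s ^ 2) (hc' : ‖c'‖ = s ^ 2)
    (h : s < ‖c' - c‖) : Real.log ‖c' - c‖ / 2 ≤ ∫ x, escapeRate c' x ∂μ := by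
  refine le_integral_escapeRate hsq h2 hμ c' 1 fun d hd => ?_
  rw [pow_one]
  refine le_preimageAvg hsq fun w _ hw => ?_
  have hd1 : ‖d.1‖ ≤ s := by
    rw [← escapeRadius_eq hs hc']
    exact hd.1
  have e : w ^ 2 + c = d.1 + -(c' - c) := by rw [hw]; ring
  -- f_c maps a first preimage w of z to z - (c' - c), whose norm is at least |c' - c| since |z| ≤ s
  -- < |c' - c|.
  have h1 := log_le_pointRate (c := c) (by rwa [escapeRadius_eq hs hc])
    (le_norm_add_of_le hd1 h (norm_neg (c' - c)).ge)
  show Real.log ‖c' - c‖ / 2 ≤ pointRate c w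
  rw [pointRate_eq_half, e]
  linarith

theorem log_mul_le_integral_of_norm_sub_le (hsq : ∀ u : L, ∃ w, w ^ 2 = u) (h2 : ‖(2 : L)‖ = 1)
    (hμ : HasLaplacian (escapeRate c) μ) (hs : 1 < s) (hc : ‖c‖ = s ^ 2) (hc' : ‖c'‖ = s ^ 2)
    (h1 : 1 < ‖c' - c‖) (h : ‖c' - c‖ ≤ s) :
    Real.log (‖c' - c‖ * s) / 8 ≤ ∫ x, escapeRate c' x ∂μ := by
  refine le_integral_escapeRate hsq h2 hμ c' 2 fun d hd => ?_
  have hR := escapeRadius_eq hs hc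
  have hd1 : ‖d.1‖ ≤ s := by
    rw [← escapeRadius_eq hs hc']
    exact hd.1
  rw [pow_two, Module.End.mul_apply, show Real.log (‖c' - c‖ * s) / 8 =
    Real.log (‖c' - c‖ * s) / 4 / 2 by ring]
  refine half_le_preimageAvg hsq (preimageAvg_nonneg fun _ => pointRate_nonneg c _) fun y hy => ?_
  have hys := norm_eq_of_sq_eq_sub hs hc' hd1 hy
  have key : ∀ y', y' ^ 2 = d.1 - c' → s ≤ ‖(c' - c) - 2 * y'‖ → ∀ t : {r : ℝ // 0 < r},
      Real.log (‖c' - c‖ * s) / 4 ≤ preimageAvg c' (fun d => pointRate c d.1) (y', t) :=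
    fun y' hy' hle t => le_preimageAvg hsq fun x _ hx =>
      log_le_pointRate_two hy' hx
        (by rw [hR]; exact IsUltrametricDist.norm_sub_le_of_le hd1 h)
        (by rw [hR]; nlinarith) (by rw [norm_mul]; gcongr)
  -- The values δ ∓ 2y differ by 4y, of norm s, so at least one has norm at least s. That loses half
  -- of the average.
  refine (le_norm_or_le_norm (a := (c' - c) - 2 * y) (b := (c' - c) - 2 * (-y)) (t := s) ?_).imp
    (key y hy) (key (-y) (by rw [neg_sq, hy]))
  have e : (c' - c) - 2 * y - ((c' - c) - 2 * (-y)) = -(2 * 2 * y) := by ring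
  rw [e, norm_neg, norm_mul, norm_mul, h2, one_mul, one_mul, hys]

theorem log_le_integral_of_norm_sub_le_one (hsq : ∀ u : L, ∃ w, w ^ 2 = u) (h2 : ‖(2 : L)‖ = 1)
    (hμ : HasLaplacian (escapeRate c) μ) (hs : 1 < s) (hc : ‖c‖ = s ^ 2) (hc' : ‖c'‖ = s ^ 2)
    (h1 : 1 < ‖c' - c‖ * s) (h : ‖c' - c‖ ≤ 1) :
    Real.log s / 8 ≤ ∫ x, escapeRate c' x ∂μ := by
  refine le_integral_escapeRate hsq h2 hμ c' 3 fun d hd => ?_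
  have hs0 : 0 < s := by linarith
  have hR := escapeRadius_eq hs hc
  have hd1 : ‖d.1‖ ≤ s := by
    rw [← escapeRadius_eq hs hc']
    exact hd.1
  have hz : ‖d.1 - (c' - c)‖ ≤ escapeRadius c := by
    rw [hR]; exact IsUltrametricDist.norm_sub_le_of_le hd1 (h.trans hs.le)
  have ht : s < ‖c' - c‖ * s * s := by nlinarith
  have hδ1 : ‖(c' - c) - 1‖ ≤ 1 := IsUltrametricDist.norm_sub_le_of_le h norm_one.le
  rw [pow_succ', Module.End.mul_apply, pow_two, Module.End.mul_apply]
  refine le_preimageAvg hsq fun p₂ r₂ hp₂ => ?_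
  have hn₂ := norm_eq_of_sq_eq_sub hs hc' hd1 hp₂
  have hε : ∀ p₁, p₁ ^ 2 = p₂ - c' → ‖(c' - c) * ((c' - c) - 1 - 2 * p₁)‖ = ‖c' - c‖ * s :=
    fun p₁ hp₁ => by
      have hn₁ := norm_eq_of_sq_eq_sub hs hc' hn₂.le hp₁
      have h2p : ‖-(2 * p₁)‖ = s := by rw [norm_neg, norm_mul, h2, one_mul, hn₁]
      rw [norm_mul, sub_eq_add_neg _ (2 * p₁), add_comm (c' - c - 1),
        IsUltrametricDist.norm_add_eq_of_lt, h2p]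
      rw [h2p]
      exact hδ1.trans_lt hs
  have key : ∀ p₁, p₁ ^ 2 = p₂ - c' →
      s ≤ ‖(c' - c) * ((c' - c) - 1 - 2 * p₁) + 2 * p₂‖ → ∀ t : {r : ℝ // 0 < r},
      Real.log (‖c' - c‖ * s * s) / 8 ≤ preimageAvg c' (fun d => pointRate c d.1) (p₁, t) :=
    fun p₁ hp₁ hle t => le_preimageAvg hsq fun p₀ _ hp₀ =>
      log_le_pointRate_three hp₂ hp₁ hp₀ rfl hz (by rwa [hR])
        (by rw [norm_mul, hε p₁ hp₁]; gcongr)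
  -- Here |ε| = |δ| s. If |δ| < 1, the term 2p₂ of norm s dominates ε for every preimage. If |δ| =
  -- 1, the two may cancel, but changing the sign of p₁ moves ε by 4δp₁, of norm s, so half of the
  -- preimages survive; the bound s² in place of s makes up for the loss.
  rcases h.lt_or_eq with hlt | heq
  · have hlog : Real.log s ≤ Real.log (‖c' - c‖ * s * s) := Real.log_le_log hs0 ht.le
    refine le_preimageAvg hsq fun p₁ r₁ hp₁ => le_trans (by linarith) (key p₁ hp₁ ?_ r₁)
    have h2p : ‖2 * p₂‖ = s := by rw [norm_mul, h2, one_mul, hn₂]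
    refine le_norm_add_of_le (hε p₁ hp₁).le ?_ h2p.ge
    nlinarith
  · rw [heq, one_mul, Real.log_mul hs0.ne' hs0.ne'] at key
    rw [show Real.log s / 8 = (Real.log s + Real.log s) / 8 / 2 by ring]
    refine half_le_preimageAvg hsq (preimageAvg_nonneg fun _ => pointRate_nonneg c _)
      fun p₁ hp₁ => ?_
    have hn₁ := norm_eq_of_sq_eq_sub hs hc' hn₂.le hp₁
    refine (le_norm_or_le_norm (t := s) ?_).imp (key p₁ hp₁) (key (-p₁) (by rw [neg_sq, hp₁]))
    have e : (c' - c) * ((c' - c) - 1 - 2 * p₁) + 2 * p₂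
        - ((c' - c) * ((c' - c) - 1 - 2 * (-p₁)) + 2 * p₂) = -(2 * 2 * (c' - c) * p₁) := by ring
    rw [e, norm_neg, norm_mul, norm_mul, norm_mul, h2, one_mul, one_mul, heq, one_mul, hn₁]

/-- The constant 1/4 comes from the range 1 < |δ| ≤ s, where log(|δ| s) / 8 ≥ log |δ| / 4; the other
cases give 1/2 or are trivial. -/
theorem quarter_posLog_le_integral (hsq : ∀ u : L, ∃ w, w ^ 2 = u) (h2 : ‖(2 : L)‖ = 1)
    (hμ : HasLaplacian (escapeRate c) μ) :
    1 / 4 * Real.posLog ‖c' - c‖ ≤ ∫ x, escapeRate c' x ∂μ := by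
  rcases le_or_gt ‖c' - c‖ 1 with h1 | h1
  · rw [(Real.posLog_eq_zero_iff _).2 (by rwa [abs_norm]), mul_zero]
    exact integral_nonneg (escapeRate_nonneg c')
  rw [Real.posLog_eq_log (by rw [abs_norm]; exact h1.le)]
  have hl := Real.log_pos h1
  have hm : ‖c' - c‖ ≤ max ‖c'‖ ‖c‖ := by
    rw [sub_eq_add_neg, ← norm_neg c]
    exact IsUltrametricDist.norm_add_le_max c' (-c)
  have hp : 0 < ‖c' - c‖ := by linarith
  rcases lt_trichotomy ‖c'‖ ‖c‖ with h | h | h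
  · rw [max_eq_right h.le] at hm
    have := half_log_le_integral_of_norm_lt hsq h2 hμ (h1.trans_le hm) h
    linarith [Real.log_le_log hp hm]
  · rw [h, max_self] at hm
    have hs : 1 < √‖c‖ := by
      rw [Real.lt_sqrt zero_le_one, one_pow]
      exact h1.trans_le hm
    have hc := (Real.sq_sqrt (norm_nonneg c)).symm
    rcases lt_or_ge √‖c‖ ‖c' - c‖ with h3 | h3
    · have := half_log_le_integral_of_lt_norm_sub hsq h2 hμ hs hc (h.trans hc) h3
      linarith
    · have := log_mul_le_integral_of_norm_sub_le hsq h2 hμ hs hc (h.trans hc) h1 h3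
      rw [Real.log_mul hp.ne' (by positivity)] at this
      linarith [Real.log_le_log hp h3]
  · rw [max_eq_left h.le] at hm
    have := half_log_le_integral_of_norm_gt hsq h2 hμ (h1.trans_le hm) h
    linarith [Real.log_le_log hp hm]

theorem log_div_eight_le_integral (hsq : ∀ u : L, ∃ w, w ^ 2 = u) (h2 : ‖(2 : L)‖ = 1)
    (hμ : HasLaplacian (escapeRate c) μ) (hs : 1 < s) (hc : ‖c‖ = s ^ 2) (hc' : ‖c'‖ = s ^ 2)
    (h : 1 < ‖c' - c‖ * s) : Real.log s / 8 ≤ ∫ x, escapeRate c' x ∂μ := by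
  have hs0 : 0 < s := by linarith
  have hl := Real.log_pos hs
  rcases le_or_gt ‖c' - c‖ 1 with h1 | h1
  · exact log_le_integral_of_norm_sub_le_one hsq h2 hμ hs hc hc' h h1
  rcases lt_or_ge s ‖c' - c‖ with h3 | h3
  · have := half_log_le_integral_of_lt_norm_sub hsq h2 hμ hs hc hc' h3
    linarith [Real.log_le_log hs0 h3.le]
  · have := log_mul_le_integral_of_norm_sub_le hsq h2 hμ hs hc hc' h1 h3
    rw [Real.log_mul (by positivity) hs0.ne'] at this
    linarith [Real.log_pos h1]

end LowerBounds

/-! ### The bounds in terms of the absolute value on `K` -/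

theorem log_max_escapeRadius {L : Type*} [NormedField L] (c c' : L) :
    Real.log (max (escapeRadius c') (escapeRadius c)) = 1 / 2 * Real.posLog (max ‖c'‖ ‖c‖) := by
  have hm : max (escapeRadius c') (escapeRadius c) = √(max 1 (max ‖c'‖ ‖c‖)) := by
    have hmono : Monotone Real.sqrt := fun _ _ => Real.sqrt_le_sqrt
    rw [hmono.map_max, hmono.map_max, Real.sqrt_one, escapeRadius, escapeRadius,
      max_max_max_comm, max_self]
  rw [hm, Real.log_sqrt (by positivity), Real.posLog_eq_log_max_one (by positivity)]
  ring

end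

theorem mainTheorem8 {K : Type*} [Field K] [NumberField K] (v : NonarchPlace K)
    (h2 : ¬ v.abv 2 < 1) (c₁ c₂ : K) :
    Integrable (escapeRate (v.toCv c₁)) (canonicalMeasure (v.toCv c₂)) ∧
    (1 / 4 : ℝ) * Real.posLog (v.abv (c₁ - c₂)) ≤ v.localEnergy c₁ c₂ ∧
    v.localEnergy c₁ c₂ ≤ (1 / 2 : ℝ) * Real.posLog (max (v.abv c₁) (v.abv c₂)) ∧
    ∀ r : ℝ, v.abv c₁ = r → v.abv c₂ = r → 1 < r →
      1 / r ^ (1 / 2 : ℝ) < v.abv (c₁ - c₂) →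
      (1 / 16 : ℝ) * Real.log r ≤ v.localEnergy c₁ c₂ := by
  have hsq := v.exists_sq_eq
  have hnorm2 : ‖(2 : v.Cv)‖ = 1 := by
    refine le_antisymm ?_ ?_
    · exact_mod_cast IsUltrametricDist.norm_natCast_le_one v.Cv 2
    · rw [← map_ofNat v.toCv 2, v.norm_toCv]
      exact not_lt.1 h2
  obtain ⟨_, hμ⟩ := canonicalMeasure_spec hsq hnorm2 (v.toCv c₂)
  simp only [← v.norm_toCv, map_sub]
  refine ⟨integrable_escapeRate hμ _, quarter_posLog_le_integral hsq hnorm2 hμ, ?_, ?_⟩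
  · rw [← log_max_escapeRadius]
    exact integral_escapeRate_le hsq hnorm2 hμ _
  · intro r h₁ h₂ hr hlt
    have hr0 : 0 ≤ r := by linarith
    have hs : 1 < √r := by rwa [Real.lt_sqrt zero_le_one, one_pow]
    have hr2 := (Real.sq_sqrt hr0).symm
    rw [← Real.sqrt_eq_rpow, div_lt_iff₀ (by positivity)] at hlt
    -- With s = √r, the bound log s / 8 is log r / 16.
    have := log_div_eight_le_integral hsq hnorm2 hμ hs (h₂.trans hr2) (h₁.trans hr2) hlt
    rw [Real.log_sqrt hr0] at this
    refine le_trans (by linarith) this
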